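/- **Snake lemma for internal groupoids.** Let $\mathcal A$ be a pointed regular category with reflexive coequalizers. Composition is written in diagrammatic order. For a groupoid $\mathbb B=(d,c\colon B_1\rightrightarrows B_0,\ e,\ m,\ i)$ internal to $\mathcal A$, let $\eta_{\mathbb B}\colon B_0\to\pi_0(\mathbb B)$ be the coequalizer of $d$ and $c$, let $\epsilon_{\mathbb B}\colon\pi_1(\mathbb B)\to B_1$ be the joint kernel of $d$ and $c$, and call $\mathbb B$ *proper* if the factorization of $(d,c)$ through the kernel pair of $\eta_{\mathbb B}$ is a regular epimorphism. An internal functor $F\colon\mathbb A\to\mathbb B$ is a *fibration* if the arrow $\tau_d=\langle d,F_1\rangle\colon A_1\to A_0\times_{F_0,d}B_1$ is a regular epimorphism. Write $K_F\colon \mathrm{Ker}(F)\to\mathbb A$ for the componentwise kernel of $F$, and $K(F)\colon\mathbb K(F)\to\mathbb A$, $k(F)\colon 0\Rightarrow K(F)\cdot F$ for the strong h-kernel, i.e. the limit of $0\to\mathbb B\xleftarrow{\delta}\vec{\mathbb B}\xrightarrow{\gamma}\mathbb B\xleftarrow{F}\mathbb A$, where $\vec{\mathbb B}$ is the groupoid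 of arrows and commutative squares of $\mathbb B$ and $\delta,\gamma$ are its domain and codomain functors. Let $J\colon\mathrm{Ker}(F)\to\mathbb K(F)$ be the canonical comparison, induced by $K_F$ and the identity transformation of $0=K_F\cdot F$. Let $D=\Delta\cdot\eta_{\mathbb K(F)}\colon\pi_1(\mathbb B)\to\pi_0(\mathbb K(F))$, where $\Delta\colon\pi_1(\mathbb B)\to\mathbb K(F)_0$ is determined by $\Delta\cdot k(F)_0=\epsilon_{\mathbb B}$ and $\Delta\cdot K(F)_0=0$. A sequence $X\xrightarrow{f}Y\xrightarrow{g}Z$ is exact at $Y$ if $f\cdot g=0$ and the factorization of $f$ through the kernel of $g$ is a regular epimorphism. Let $F\colon\mathbb A\to\mathbb B$ be a fibration between groupoids in $\mathcal A$. If $\mathbb A$, $\mathbb B$ and $\mathbb K(F)$ are proper, then there is an arrow $\delta_F\colon\pi_1(\mathbb B)\to\pi_0(\mathrm{Ker}(F))$ such that the sequence $$\pi_1(\mathrm{Ker}(F))\xrightarrow{\pi_1(K_F)}\pi_1(\mathbb A)\xrightarrow{\pi_1(F)}\pi_1(\mathbb B)\xrightarrow{\ \delta_F\ }\pi_0(\mathrm{Ker}(F))\xrightarrow{\pi_0(K_F)}\pi_0(\mathbb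 A)\xrightarrow{\pi_0(F)}\pi_0(\mathbb B)$$ is exact at each of its four inner objects. Moreover, this sequence is the snail sequence of $F$ with $\mathrm{Ker}(F)$ in place of $\mathbb K(F)$: the arrows $\pi_1(J)$ and $\pi_0(J)$ are isomorphisms, $\pi_1(J)\cdot\pi_1(K(F))=\pi_1(K_F)$, $\pi_0(J)\cdot\pi_0(K(F))=\pi_0(K_F)$, and $\delta_F\cdot\pi_0(J)=D$. -/

import Mathlib

open CategoryTheory CategoryTheory.Limits

universe v u

namespace IntGrpd

attribute [local simp] pullback.lift_fst pullback.lift_snd pullback.lift_fst_assoc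
  pullback.lift_snd_assoc

/-! ## Groupoids, functors and natural transformations internal to a category -/

section Basic

variable {C : Type u} [Category.{v} C] [HasFiniteLimits C]

/-- The structure maps of an internal groupoid. Composition is written in diagrammatic order:
it is defined on the pullback of `cod` (first arrow) and `dom` (second arrow). -/
structure GroupoidData (C : Type u) [Category.{v} C] [HasFiniteLimits C] where
  obj : C
  arr : C
  dom : arr ⟶ obj
  cod : arr ⟶ obj
  idn : obj ⟶ arr
  comp : pullback cod dom ⟶ arr
  inv : arr ⟶ arr

/-- The composite of two composable generalized arrows `f, g : X ⟶ B₁`. -/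
noncomputable def GroupoidData.mul (B : GroupoidData C) {X : C} (f g : X ⟶ B.arr)
    (h : f ≫ B.cod = g ≫ B.dom) : X ⟶ B.arr :=
  pullback.lift f g h ≫ B.comp

theorem GroupoidData.comp_mul (B : GroupoidData C) {X Y : C} (x : Y ⟶ X) (f g : X ⟶ B.arr)
    (h : f ≫ B.cod = g ≫ B.dom) :
    x ≫ B.mul f g h = B.mul (x ≫ f) (x ≫ g) (by simp [h]) := by
  unfold GroupoidData.mul
  rw [← Category.assoc]
  congr 1
  ext <;> simp

theorem GroupoidData.mul_congr (B : GroupoidData C) {X : C} {f g f' g' : X ⟶ B.arr}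
    (hf : f = f') (hg : g = g') (h : f ≫ B.cod = g ≫ B.dom) :
    B.mul f g h = B.mul f' g' (by rw [← hf, ← hg, h]) := by
  subst hf hg; rfl

theorem GroupoidData.mul_dom_of (B : GroupoidData C)
    (hB : B.comp ≫ B.dom = pullback.fst B.cod B.dom ≫ B.dom) {X : C} (f g : X ⟶ B.arr)
    (h : f ≫ B.cod = g ≫ B.dom) : B.mul f g h ≫ B.dom = f ≫ B.dom := by
  simp [GroupoidData.mul, hB]

theorem GroupoidData.mul_cod_of (B : GroupoidData C)
    (hB : B.comp ≫ B.cod = pullback.snd B.cod B.dom ≫ B.cod) {X : C} (f g : X ⟶ B.arr)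
    (h : f ≫ B.cod = g ≫ B.dom) : B.mul f g h ≫ B.cod = g ≫ B.cod := by
  simp [GroupoidData.mul, hB]

/-- A groupoid internal to `C`. Associativity is stated for all composable triples of generalized
arrows, which by the Yoneda lemma is the usual diagram on the object of composable triples. -/
structure InternalGroupoid (C : Type u) [Category.{v} C] [HasFiniteLimits C] extends
    GroupoidData C where
  idn_dom : idn ≫ dom = 𝟙 obj
  idn_cod : idn ≫ cod = 𝟙 obj
  comp_dom : comp ≫ dom = pullback.fst cod dom ≫ dom
  comp_cod : comp ≫ cod = pullback.snd cod dom ≫ cod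
  inv_dom : inv ≫ dom = cod
  inv_cod : inv ≫ cod = dom
  idn_mul : toGroupoidData.mul (dom ≫ idn) (𝟙 arr) (by simp [toGroupoidData, idn_cod]) = 𝟙 arr
  mul_idn : toGroupoidData.mul (𝟙 arr) (cod ≫ idn) (by simp [toGroupoidData, idn_dom]) = 𝟙 arr
  mul_inv : toGroupoidData.mul (𝟙 arr) inv (by simp [toGroupoidData, inv_dom]) = dom ≫ idn
  inv_mul : toGroupoidData.mul inv (𝟙 arr) (by simp [toGroupoidData, inv_cod]) = cod ≫ idn
  mul_assoc : ∀ {X : C} (f g h : X ⟶ arr) (hfg : f ≫ cod = g ≫ dom) (hgh : g ≫ cod = h ≫ dom),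
    toGroupoidData.mul (toGroupoidData.mul f g hfg) h
        (by rw [toGroupoidData.mul_cod_of comp_cod, hgh]) =
      toGroupoidData.mul f (toGroupoidData.mul g h hgh)
        (by rw [toGroupoidData.mul_dom_of comp_dom, hfg])

namespace InternalGroupoid

variable (B : InternalGroupoid C) {X : C}

theorem mul_dom (f g : X ⟶ B.arr) (h : f ≫ B.cod = g ≫ B.dom) :
    B.mul f g h ≫ B.dom = f ≫ B.dom := B.mul_dom_of B.comp_dom f g h

theorem mul_cod (f g : X ⟶ B.arr) (h : f ≫ B.cod = g ≫ B.dom) :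
    B.mul f g h ≫ B.cod = g ≫ B.cod := B.mul_cod_of B.comp_cod f g h

theorem idn_mul' (f : X ⟶ B.arr) (x : X ⟶ B.obj) (h : (x ≫ B.idn) ≫ B.cod = f ≫ B.dom) :
    B.mul (x ≫ B.idn) f h = f := by
  have hx : x = f ≫ B.dom := by simpa [B.idn_cod] using h
  have := congrArg (f ≫ ·) B.idn_mul
  simp only [B.comp_mul, Category.comp_id] at this
  exact (B.mul_congr (by simp [hx]) rfl h).trans this

theorem mul_idn' (f : X ⟶ B.arr) (x : X ⟶ B.obj) (h : f ≫ B.cod = (x ≫ B.idn) ≫ B.dom) :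
    B.mul f (x ≫ B.idn) h = f := by
  have hx : x = f ≫ B.cod := by simpa [B.idn_dom] using h.symm
  have := congrArg (f ≫ ·) B.mul_idn
  simp only [B.comp_mul, Category.comp_id] at this
  exact (B.mul_congr rfl (by simp [hx]) h).trans this

theorem mul_inv' (f : X ⟶ B.arr) (h : f ≫ B.cod = (f ≫ B.inv) ≫ B.dom) :
    B.mul f (f ≫ B.inv) h = f ≫ B.dom ≫ B.idn := by
  have := congrArg (f ≫ ·) B.mul_inv
  simpa only [B.comp_mul, Category.comp_id] using this

theorem inv_mul' (f : X ⟶ B.arr) (h : (f ≫ B.inv) ≫ B.cod = f ≫ B.dom) :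
    B.mul (f ≫ B.inv) f h = f ≫ B.cod ≫ B.idn := by
  have := congrArg (f ≫ ·) B.inv_mul
  simpa only [B.comp_mul, Category.comp_id] using this

theorem comp_eq {x : X ⟶ pullback B.cod B.dom} : x ≫ B.comp =
    B.mul (x ≫ pullback.fst B.cod B.dom) (x ≫ pullback.snd B.cod B.dom)
      (by rw [Category.assoc, Category.assoc, pullback.condition]) := by
  rw [GroupoidData.mul]
  congr 1
  apply pullback.hom_ext <;> simp

end InternalGroupoid

/-- A functor between internal groupoids. -/
@[ext]
structure InternalFunctor (A B : InternalGroupoid C) where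
  map₀ : A.obj ⟶ B.obj
  map₁ : A.arr ⟶ B.arr
  map_dom : map₁ ≫ B.dom = A.dom ≫ map₀
  map_cod : map₁ ≫ B.cod = A.cod ≫ map₀
  map_idn : A.idn ≫ map₁ = map₀ ≫ B.idn
  map_comp : A.comp ≫ map₁ =
    B.mul (pullback.fst A.cod A.dom ≫ map₁) (pullback.snd A.cod A.dom ≫ map₁)
      (by simp only [Category.assoc, map_cod, map_dom]
          rw [← Category.assoc, pullback.condition, Category.assoc])

namespace InternalFunctor

variable {A B D : InternalGroupoid C}

theorem map_mul (F : InternalFunctor A B) {X : C} (f g : X ⟶ A.arr)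
    (h : f ≫ A.cod = g ≫ A.dom) :
    A.mul f g h ≫ F.map₁ = B.mul (f ≫ F.map₁) (g ≫ F.map₁)
      (by simp only [Category.assoc, F.map_cod, F.map_dom]
          rw [← Category.assoc, h, Category.assoc]) := by
  rw [GroupoidData.mul, Category.assoc, F.map_comp, B.comp_mul]
  exact B.mul_congr (by simp) (by simp) _

/-- Functors preserve inverses. -/
theorem map_inv (F : InternalFunctor A B) : A.inv ≫ F.map₁ = F.map₁ ≫ B.inv := by
  have h1 : (F.map₁ ≫ B.inv) ≫ B.cod = F.map₁ ≫ B.dom := by simp [B.inv_cod]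
  have h2 : F.map₁ ≫ B.cod = (A.inv ≫ F.map₁) ≫ B.dom := by
    simp only [Category.assoc, F.map_dom, F.map_cod]
    rw [← Category.assoc, A.inv_dom]
  have key := B.mul_assoc (F.map₁ ≫ B.inv) F.map₁ (A.inv ≫ F.map₁) h1 h2
  have e1 : B.mul (F.map₁ ≫ B.inv) F.map₁ h1 = (F.map₁ ≫ B.cod) ≫ B.idn := by
    rw [B.inv_mul', Category.assoc]
  have e2 : B.mul F.map₁ (A.inv ≫ F.map₁) h2 = (F.map₁ ≫ B.dom) ≫ B.idn := by
    have := F.map_mul (𝟙 _) A.inv (by simp [A.inv_dom])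
    rw [A.mul_inv] at this
    rw [F.map_dom, Category.assoc, ← F.map_idn, ← Category.assoc, this]
    exact B.mul_congr (by simp) rfl _
  rw [B.mul_congr e1 rfl, B.mul_congr rfl e2, B.idn_mul', B.mul_idn'] at key
  exact key

/-- The composite functor, in diagrammatic order. -/
def comp (F : InternalFunctor A B) (G : InternalFunctor B D) : InternalFunctor A D where
  map₀ := F.map₀ ≫ G.map₀
  map₁ := F.map₁ ≫ G.map₁
  map_dom := by rw [Category.assoc, G.map_dom, ← Category.assoc, F.map_dom, Category.assoc]
  map_cod := by rw [Category.assoc, G.map_cod, ← Category.assoc, F.map_cod, Category.assoc]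
  map_idn := by rw [← Category.assoc, F.map_idn, Category.assoc, G.map_idn, Category.assoc]
  map_comp := by
    rw [← Category.assoc, F.map_comp, G.map_mul]
    exact D.mul_congr (by simp) (by simp) _

/-- `F` is a fibration if the canonical arrow `τ_d : A₁ ⟶ A₀ ×_{F₀,d} B₁` is a regular epi. -/
def IsFibration (F : InternalFunctor A B) : Prop :=
  IsRegularEpi (pullback.lift A.dom F.map₁ F.map_dom.symm : A.arr ⟶ pullback F.map₀ B.dom)

end InternalFunctor

/-- A natural transformation `F ⇒ G` between internal functors. -/
@[ext]
structure InternalNatTrans {A B : InternalGroupoid C} (F G : InternalFunctor A B) where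
  app : A.obj ⟶ B.arr
  app_dom : app ≫ B.dom = F.map₀
  app_cod : app ≫ B.cod = G.map₀
  naturality :
    B.mul F.map₁ (A.cod ≫ app) (by rw [F.map_cod, Category.assoc, app_dom]) =
      B.mul (A.dom ≫ app) G.map₁ (by rw [Category.assoc, app_cod, G.map_dom])

/-! ## The levelwise pullback of internal functors -/

section Pullback

variable {A B D : InternalGroupoid C}

section

variable (F : InternalFunctor A B) (G : InternalFunctor D B)

noncomputable def pbDom : pullback F.map₁ G.map₁ ⟶ pullback F.map₀ G.map₀ :=
  pullback.lift (pullback.fst _ _ ≫ A.dom) (pullback.snd _ _ ≫ D.dom)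
    (by rw [Category.assoc, Category.assoc, ← F.map_dom, ← G.map_dom, pullback.condition_assoc])

noncomputable def pbCod : pullback F.map₁ G.map₁ ⟶ pullback F.map₀ G.map₀ :=
  pullback.lift (pullback.fst _ _ ≫ A.cod) (pullback.snd _ _ ≫ D.cod)
    (by rw [Category.assoc, Category.assoc, ← F.map_cod, ← G.map_cod, pullback.condition_assoc])

theorem pbDom_fst : pbDom F G ≫ pullback.fst F.map₀ G.map₀ = pullback.fst F.map₁ G.map₁ ≫ A.dom :=
  pullback.lift_fst _ _ _

theorem pbDom_snd : pbDom F G ≫ pullback.snd F.map₀ G.map₀ = pullback.snd F.map₁ G.map₁ ≫ D.dom :=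
  pullback.lift_snd _ _ _

theorem pbCod_fst : pbCod F G ≫ pullback.fst F.map₀ G.map₀ = pullback.fst F.map₁ G.map₁ ≫ A.cod :=
  pullback.lift_fst _ _ _

theorem pbCod_snd : pbCod F G ≫ pullback.snd F.map₀ G.map₀ = pullback.snd F.map₁ G.map₁ ≫ D.cod :=
  pullback.lift_snd _ _ _

theorem pb_comm_fst {X : C} {f g : X ⟶ pullback F.map₁ G.map₁}
    (h : f ≫ pbCod F G = g ≫ pbDom F G) :
    (f ≫ pullback.fst F.map₁ G.map₁) ≫ A.cod = (g ≫ pullback.fst F.map₁ G.map₁) ≫ A.dom := by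
  simpa [pbCod, pbDom] using h =≫ pullback.fst F.map₀ G.map₀

theorem pb_comm_snd {X : C} {f g : X ⟶ pullback F.map₁ G.map₁}
    (h : f ≫ pbCod F G = g ≫ pbDom F G) :
    (f ≫ pullback.snd F.map₁ G.map₁) ≫ D.cod = (g ≫ pullback.snd F.map₁ G.map₁) ≫ D.dom := by
  simpa [pbCod, pbDom] using h =≫ pullback.snd F.map₀ G.map₀

/-- Composition in a levelwise pullback is componentwise. -/
noncomputable def pbComp : pullback (pbCod F G) (pbDom F G) ⟶ pullback F.map₁ G.map₁ :=
  pullback.lift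
    (A.mul (pullback.fst (pbCod F G) (pbDom F G) ≫ pullback.fst F.map₁ G.map₁)
      (pullback.snd (pbCod F G) (pbDom F G) ≫ pullback.fst F.map₁ G.map₁)
      (pb_comm_fst F G pullback.condition))
    (D.mul (pullback.fst (pbCod F G) (pbDom F G) ≫ pullback.snd F.map₁ G.map₁)
      (pullback.snd (pbCod F G) (pbDom F G) ≫ pullback.snd F.map₁ G.map₁)
      (pb_comm_snd F G pullback.condition))
    (by rw [F.map_mul, G.map_mul]
        exact B.mul_congr (by rw [Category.assoc, Category.assoc, pullback.condition])
          (by rw [Category.assoc, Category.assoc, pullback.condition]) _)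

/-- The structure maps of the levelwise pullback of two internal functors. -/
noncomputable abbrev pullbackData : GroupoidData C where
  obj := pullback F.map₀ G.map₀
  arr := pullback F.map₁ G.map₁
  dom := pbDom F G
  cod := pbCod F G
  idn := pullback.lift (pullback.fst _ _ ≫ A.idn) (pullback.snd _ _ ≫ D.idn)
    (by rw [Category.assoc, Category.assoc, F.map_idn, G.map_idn, pullback.condition_assoc])
  comp := pbComp F G
  inv := pullback.lift (pullback.fst _ _ ≫ A.inv) (pullback.snd _ _ ≫ D.inv)
    (by rw [Category.assoc, Category.assoc, F.map_inv, G.map_inv, pullback.condition_assoc])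

theorem pullbackData_mul_fst {X : C} (f g : X ⟶ pullback F.map₁ G.map₁)
    (h : f ≫ pbCod F G = g ≫ pbDom F G) :
    (pullbackData F G).mul f g h ≫ pullback.fst F.map₁ G.map₁ =
      A.mul (f ≫ pullback.fst F.map₁ G.map₁) (g ≫ pullback.fst F.map₁ G.map₁)
        (pb_comm_fst F G h) := by
  change (pullback.lift f g h ≫ pbComp F G) ≫ _ = _
  rw [Category.assoc, pbComp, pullback.lift_fst, A.comp_mul]
  exact A.mul_congr (by rw [pullback.lift_fst_assoc]) (by rw [pullback.lift_snd_assoc]) _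

theorem pullbackData_mul_snd {X : C} (f g : X ⟶ pullback F.map₁ G.map₁)
    (h : f ≫ pbCod F G = g ≫ pbDom F G) :
    (pullbackData F G).mul f g h ≫ pullback.snd F.map₁ G.map₁ =
      D.mul (f ≫ pullback.snd F.map₁ G.map₁) (g ≫ pullback.snd F.map₁ G.map₁)
        (pb_comm_snd F G h) := by
  change (pullback.lift f g h ≫ pbComp F G) ≫ _ = _
  rw [Category.assoc, pbComp, pullback.lift_snd, D.comp_mul]
  exact D.mul_congr (by rw [pullback.lift_fst_assoc]) (by rw [pullback.lift_snd_assoc]) _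

/-- The levelwise pullback of two internal functors, as an internal groupoid. -/
noncomputable abbrev pullbackGroupoid : InternalGroupoid C where
  toGroupoidData := pullbackData F G
  idn_dom := by apply pullback.hom_ext <;> simp [pullbackData, pbDom, A.idn_dom, D.idn_dom]
  idn_cod := by apply pullback.hom_ext <;> simp [pullbackData, pbCod, A.idn_cod, D.idn_cod]
  comp_dom := by
    apply pullback.hom_ext
    · simp only [pullbackData, Category.assoc, pbDom_fst]
      rw [pbComp, pullback.lift_fst_assoc, A.mul_dom, Category.assoc]
    · simp only [pullbackData, Category.assoc, pbDom_snd]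
      rw [pbComp, pullback.lift_snd_assoc, D.mul_dom, Category.assoc]
  comp_cod := by
    apply pullback.hom_ext
    · simp only [pullbackData, Category.assoc, pbCod_fst]
      rw [pbComp, pullback.lift_fst_assoc, A.mul_cod, Category.assoc]
    · simp only [pullbackData, Category.assoc, pbCod_snd]
      rw [pbComp, pullback.lift_snd_assoc, D.mul_cod, Category.assoc]
  inv_dom := by apply pullback.hom_ext <;> simp [pullbackData, pbDom, pbCod, A.inv_dom, D.inv_dom]
  inv_cod := by apply pullback.hom_ext <;> simp [pullbackData, pbDom, pbCod, A.inv_cod, D.inv_cod]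
  idn_mul := by
    apply pullback.hom_ext
    · refine (pullbackData_mul_fst F G _ _ _).trans ?_
      refine (A.mul_congr (f' := (pullback.fst F.map₁ G.map₁ ≫ A.dom) ≫ A.idn) ?_ rfl _).trans ?_
      · simp [pullbackData, pbDom]
      · exact A.idn_mul' _ _ _
    · refine (pullbackData_mul_snd F G _ _ _).trans ?_
      refine (D.mul_congr (f' := (pullback.snd F.map₁ G.map₁ ≫ D.dom) ≫ D.idn) ?_ rfl _).trans ?_
      · simp [pullbackData, pbDom]
      · exact D.idn_mul' _ _ _
  mul_idn := by
    apply pullback.hom_ext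
    · refine (pullbackData_mul_fst F G _ _ _).trans ?_
      refine (A.mul_congr (g' := (pullback.fst F.map₁ G.map₁ ≫ A.cod) ≫ A.idn) rfl ?_ _).trans ?_
      · simp [pullbackData, pbCod]
      · exact A.mul_idn' _ _ _
    · refine (pullbackData_mul_snd F G _ _ _).trans ?_
      refine (D.mul_congr (g' := (pullback.snd F.map₁ G.map₁ ≫ D.cod) ≫ D.idn) rfl ?_ _).trans ?_
      · simp [pullbackData, pbCod]
      · exact D.mul_idn' _ _ _
  mul_inv := by
    apply pullback.hom_ext
    · refine (pullbackData_mul_fst F G _ _ _).trans ?_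
      refine (A.mul_congr (Category.id_comp _)
        (g' := pullback.fst F.map₁ G.map₁ ≫ A.inv) ?_ _).trans ?_
      · simp [pullbackData]
      · rw [A.mul_inv']; simp [pullbackData, pbDom]
    · refine (pullbackData_mul_snd F G _ _ _).trans ?_
      refine (D.mul_congr (Category.id_comp _)
        (g' := pullback.snd F.map₁ G.map₁ ≫ D.inv) ?_ _).trans ?_
      · simp [pullbackData]
      · rw [D.mul_inv']; simp [pullbackData, pbDom]
  inv_mul := by
    apply pullback.hom_ext
    · refine (pullbackData_mul_fst F G _ _ _).trans ?_
      refine (A.mul_congr (f' := pullback.fst F.map₁ G.map₁ ≫ A.inv) ?_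
        (Category.id_comp _) _).trans ?_
      · simp [pullbackData]
      · rw [A.inv_mul']; simp [pullbackData, pbCod]
    · refine (pullbackData_mul_snd F G _ _ _).trans ?_
      refine (D.mul_congr (f' := pullback.snd F.map₁ G.map₁ ≫ D.inv) ?_
        (Category.id_comp _) _).trans ?_
      · simp [pullbackData]
      · rw [D.inv_mul']; simp [pullbackData, pbCod]
  mul_assoc f g h hfg hgh := by
    apply pullback.hom_ext
    · refine (pullbackData_mul_fst F G _ _ _).trans ?_
      refine (A.mul_congr (pullbackData_mul_fst F G _ _ _) rfl _).trans ?_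
      refine Eq.trans ?_ (pullbackData_mul_fst F G _ _ _).symm
      refine Eq.trans ?_ (A.mul_congr rfl (pullbackData_mul_fst F G _ _ _) _).symm
      exact A.mul_assoc _ _ _ _ _
    · refine (pullbackData_mul_snd F G _ _ _).trans ?_
      refine (D.mul_congr (pullbackData_mul_snd F G _ _ _) rfl _).trans ?_
      refine Eq.trans ?_ (pullbackData_mul_snd F G _ _ _).symm
      refine Eq.trans ?_ (D.mul_congr rfl (pullbackData_mul_snd F G _ _ _) _).symm
      exact D.mul_assoc _ _ _ _ _

/-- The first projection of the levelwise pullback. -/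
noncomputable def pullbackFst : InternalFunctor (pullbackGroupoid F G) A where
  map₀ := pullback.fst F.map₀ G.map₀
  map₁ := pullback.fst F.map₁ G.map₁
  map_dom := by simp [pullbackGroupoid, pullbackData, pbDom]
  map_cod := by simp [pullbackGroupoid, pullbackData, pbCod]
  map_idn := by simp [pullbackGroupoid, pullbackData]
  map_comp := by simp [pullbackGroupoid, pullbackData, pbComp]

/-- The second projection of the levelwise pullback. -/
noncomputable def pullbackSnd : InternalFunctor (pullbackGroupoid F G) D where
  map₀ := pullback.snd F.map₀ G.map₀
  map₁ := pullback.snd F.map₁ G.map₁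
  map_dom := by simp [pullbackGroupoid, pullbackData, pbDom]
  map_cod := by simp [pullbackGroupoid, pullbackData, pbCod]
  map_idn := by simp [pullbackGroupoid, pullbackData]
  map_comp := by simp [pullbackGroupoid, pullbackData, pbComp]

end

/-- The functor into a levelwise pullback induced by its universal property. -/
noncomputable def pullbackLift {F : InternalFunctor A B} {G : InternalFunctor D B}
    {X : InternalGroupoid C} (S : InternalFunctor X A) (T : InternalFunctor X D)
    (h₀ : S.map₀ ≫ F.map₀ = T.map₀ ≫ G.map₀) (h₁ : S.map₁ ≫ F.map₁ = T.map₁ ≫ G.map₁) :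
    InternalFunctor X (pullbackGroupoid F G) where
  map₀ := pullback.lift S.map₀ T.map₀ h₀
  map₁ := pullback.lift S.map₁ T.map₁ h₁
  map_dom := by
    apply pullback.hom_ext <;>
      simp [pullbackGroupoid, pullbackData, pbDom, S.map_dom, T.map_dom]
  map_cod := by
    apply pullback.hom_ext <;>
      simp [pullbackGroupoid, pullbackData, pbCod, S.map_cod, T.map_cod]
  map_idn := by
    apply pullback.hom_ext <;>
      simp [pullbackGroupoid, pullbackData, S.map_idn, T.map_idn]
  map_comp := by
    apply pullback.hom_ext
    · refine Eq.trans ?_ (pullbackData_mul_fst F G _ _ _).symm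
      refine Eq.trans ?_ (A.mul_congr (f' := pullback.fst X.cod X.dom ≫ S.map₁)
        (g' := pullback.snd X.cod X.dom ≫ S.map₁) (by simp) (by simp) _).symm
      simpa using S.map_comp
    · refine Eq.trans ?_ (pullbackData_mul_snd F G _ _ _).symm
      refine Eq.trans ?_ (D.mul_congr (f' := pullback.fst X.cod X.dom ≫ T.map₁)
        (g' := pullback.snd X.cod X.dom ≫ T.map₁) (by simp) (by simp) _).symm
      simpa using T.map_comp

end Pullback

/-! ## The groupoid of arrows and commutative squares -/

section Arrow

variable (B : InternalGroupoid C)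

namespace InternalGroupoid

theorem mul_inv_cancel_right {X : C} (f g : X ⟶ B.arr) (h : f ≫ B.cod = g ≫ B.dom) :
    B.mul (B.mul f g h) (g ≫ B.inv) (by rw [B.mul_cod, Category.assoc, B.inv_dom]) = f := by
  rw [B.mul_assoc f g (g ≫ B.inv) h (by rw [Category.assoc, B.inv_dom])]
  refine (B.mul_congr rfl (g' := (g ≫ B.dom) ≫ B.idn) ?_ _).trans (B.mul_idn' _ _ _)
  rw [B.mul_inv', Category.assoc]

theorem inv_mul_cancel_left {X : C} (f g : X ⟶ B.arr) (h : f ≫ B.cod = g ≫ B.dom) :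
    B.mul (f ≫ B.inv) (B.mul f g h) (by rw [B.mul_dom, Category.assoc, B.inv_cod]) = g := by
  rw [← B.mul_assoc (f ≫ B.inv) f g (by rw [Category.assoc, B.inv_cod]) h]
  refine (B.mul_congr (f' := (f ≫ B.cod) ≫ B.idn) ?_ rfl _).trans (B.idn_mul' _ _ _)
  rw [B.inv_mul', Category.assoc]

end InternalGroupoid

/-- The object of commutative squares: the pullback of the composition map along itself.
A square is a pair of factorizations `src · bot = top · tgt` of the same arrow; it is regarded as
an arrow from `src` to `tgt`. -/
noncomputable abbrev sq : C := pullback B.comp B.comp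

noncomputable def sqSrc : sq B ⟶ B.arr := pullback.fst B.comp B.comp ≫ pullback.fst B.cod B.dom
noncomputable def sqBot : sq B ⟶ B.arr := pullback.fst B.comp B.comp ≫ pullback.snd B.cod B.dom
noncomputable def sqTop : sq B ⟶ B.arr := pullback.snd B.comp B.comp ≫ pullback.fst B.cod B.dom
noncomputable def sqTgt : sq B ⟶ B.arr := pullback.snd B.comp B.comp ≫ pullback.snd B.cod B.dom

theorem sq_src_bot : sqSrc B ≫ B.cod = sqBot B ≫ B.dom := by
  rw [sqSrc, sqBot, Category.assoc, Category.assoc, pullback.condition]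

theorem sq_top_tgt : sqTop B ≫ B.cod = sqTgt B ≫ B.dom := by
  rw [sqTop, sqTgt, Category.assoc, Category.assoc, pullback.condition]

theorem sq_comm : B.mul (sqSrc B) (sqBot B) (sq_src_bot B) =
    B.mul (sqTop B) (sqTgt B) (sq_top_tgt B) := by
  have h := pullback.condition (f := B.comp) (g := B.comp)
  rw [B.comp_eq, B.comp_eq] at h
  exact h

theorem sq_top_src : sqTop B ≫ B.dom = sqSrc B ≫ B.dom := by
  rw [← B.mul_dom _ _ (sq_top_tgt B), ← sq_comm, B.mul_dom]

theorem sq_bot_tgt : sqBot B ≫ B.cod = sqTgt B ≫ B.cod := by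
  rw [← B.mul_cod _ _ (sq_top_tgt B), ← sq_comm, B.mul_cod]

section Lift

variable {B} {X : C} (s b t r : X ⟶ B.arr) (h₁ : s ≫ B.cod = b ≫ B.dom)
  (h₂ : t ≫ B.cod = r ≫ B.dom) (h : B.mul s b h₁ = B.mul t r h₂)

theorem sq_lift_aux (h : B.mul s b h₁ = B.mul t r h₂) :
    pullback.lift s b h₁ ≫ B.comp = pullback.lift t r h₂ ≫ B.comp := h

/-- The generalized square with given sides. -/
noncomputable def sqLift : X ⟶ sq B :=
  pullback.lift (pullback.lift s b h₁) (pullback.lift t r h₂) (sq_lift_aux s b t r h₁ h₂ h)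

theorem sqLift_src : sqLift s b t r h₁ h₂ h ≫ sqSrc B = s := by
  rw [sqLift, sqSrc, pullback.lift_fst_assoc, pullback.lift_fst]

theorem sqLift_bot : sqLift s b t r h₁ h₂ h ≫ sqBot B = b := by
  rw [sqLift, sqBot, pullback.lift_fst_assoc, pullback.lift_snd]

theorem sqLift_top : sqLift s b t r h₁ h₂ h ≫ sqTop B = t := by
  rw [sqLift, sqTop, pullback.lift_snd_assoc, pullback.lift_fst]

theorem sqLift_tgt : sqLift s b t r h₁ h₂ h ≫ sqTgt B = r := by
  rw [sqLift, sqTgt, pullback.lift_snd_assoc, pullback.lift_snd]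

theorem sq_ext {x y : X ⟶ sq B} (hs : x ≫ sqSrc B = y ≫ sqSrc B)
    (hb : x ≫ sqBot B = y ≫ sqBot B) (ht : x ≫ sqTop B = y ≫ sqTop B)
    (hr : x ≫ sqTgt B = y ≫ sqTgt B) : x = y := by
  unfold sqSrc at hs
  unfold sqBot at hb
  unfold sqTop at ht
  unfold sqTgt at hr
  apply pullback.hom_ext <;> apply pullback.hom_ext <;> simpa only [Category.assoc]

end Lift

theorem sq_comp_bot {X : C} {p q : X ⟶ sq B} (h : p ≫ sqTgt B = q ≫ sqSrc B) :
    (p ≫ sqBot B) ≫ B.cod = (q ≫ sqBot B) ≫ B.dom := by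
  rw [Category.assoc, Category.assoc, sq_bot_tgt, ← sq_src_bot, ← Category.assoc, h,
    Category.assoc]

theorem sq_comp_top {X : C} {p q : X ⟶ sq B} (h : p ≫ sqTgt B = q ≫ sqSrc B) :
    (p ≫ sqTop B) ≫ B.cod = (q ≫ sqTop B) ≫ B.dom := by
  rw [Category.assoc, Category.assoc, sq_top_tgt, sq_top_src, ← Category.assoc, h,
    Category.assoc]

/-- Horizontal pasting of two generalized squares. -/
noncomputable def sqPaste {X : C} (p q : X ⟶ sq B) (h : p ≫ sqTgt B = q ≫ sqSrc B) : X ⟶ sq B :=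
  sqLift (p ≫ sqSrc B) (B.mul (p ≫ sqBot B) (q ≫ sqBot B) (sq_comp_bot B h))
    (B.mul (p ≫ sqTop B) (q ≫ sqTop B) (sq_comp_top B h)) (q ≫ sqTgt B)
    (by rw [B.mul_dom, Category.assoc, Category.assoc, sq_src_bot])
    (by rw [B.mul_cod, Category.assoc, Category.assoc, sq_top_tgt])
    (by
      have hp : B.mul (p ≫ sqSrc B) (p ≫ sqBot B) (by simp [sq_src_bot]) =
          B.mul (p ≫ sqTop B) (p ≫ sqTgt B) (by simp [sq_top_tgt]) := by
        rw [← B.comp_mul _ _ _ (sq_src_bot B), ← B.comp_mul _ _ _ (sq_top_tgt B), sq_comm]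
      have hq : B.mul (q ≫ sqSrc B) (q ≫ sqBot B) (by simp [sq_src_bot]) =
          B.mul (q ≫ sqTop B) (q ≫ sqTgt B) (by simp [sq_top_tgt]) := by
        rw [← B.comp_mul _ _ _ (sq_src_bot B), ← B.comp_mul _ _ _ (sq_top_tgt B), sq_comm]
      have e1 := B.mul_assoc (p ≫ sqSrc B) (p ≫ sqBot B) (q ≫ sqBot B) (by simp [sq_src_bot])
        (sq_comp_bot B h)
      have e2 := B.mul_assoc (p ≫ sqTop B) (q ≫ sqSrc B) (q ≫ sqBot B)
        (by rw [← h]; simp [sq_top_tgt]) (by simp [sq_src_bot])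
      have e3 := B.mul_assoc (p ≫ sqTop B) (q ≫ sqTop B) (q ≫ sqTgt B) (sq_comp_top B h)
        (by simp [sq_top_tgt])
      exact e1.symm.trans ((B.mul_congr (hp.trans (B.mul_congr rfl h _)) rfl _).trans
        (e2.trans ((B.mul_congr rfl hq _).trans e3.symm))))

/-- The identity square of an arrow. -/
noncomputable def sqIdn : B.arr ⟶ sq B :=
  sqLift (𝟙 _) (B.cod ≫ B.idn) (B.dom ≫ B.idn) (𝟙 _) (by simp [B.idn_dom])
    (by simp [B.idn_cod]) (by rw [B.mul_idn, B.idn_mul])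

theorem sqIdn_src : sqIdn B ≫ sqSrc B = 𝟙 _ := sqLift_src ..

theorem sqIdn_bot : sqIdn B ≫ sqBot B = B.cod ≫ B.idn := sqLift_bot ..

theorem sqIdn_top : sqIdn B ≫ sqTop B = B.dom ≫ B.idn := sqLift_top ..

theorem sqIdn_tgt : sqIdn B ≫ sqTgt B = 𝟙 _ := sqLift_tgt ..

/-- The inverse of a square, exchanging source and target. -/
noncomputable def sqInv : sq B ⟶ sq B :=
  sqLift (sqTgt B) (sqBot B ≫ B.inv) (sqTop B ≫ B.inv) (sqSrc B)
    (by rw [Category.assoc, B.inv_dom, sq_bot_tgt])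
    (by rw [Category.assoc, B.inv_cod, sq_top_src])
    (by
      have e1 := B.inv_mul_cancel_left (sqTop B) (sqTgt B) (sq_top_tgt B)
      have e2 := B.mul_inv_cancel_right (sqSrc B) (sqBot B) (sq_src_bot B)
      have e3 := B.mul_assoc (sqTop B ≫ B.inv) (B.mul (sqTop B) (sqTgt B) (sq_top_tgt B))
        (sqBot B ≫ B.inv) (by rw [B.mul_dom, Category.assoc, B.inv_cod])
        (by rw [B.mul_cod, Category.assoc, B.inv_dom, sq_bot_tgt])
      refine (B.mul_congr e1.symm rfl _).trans (e3.trans (B.mul_congr rfl ?_ _))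
      exact (B.mul_congr (sq_comm B).symm rfl _).trans e2)

theorem sqInv_src : sqInv B ≫ sqSrc B = sqTgt B := sqLift_src ..

theorem sqInv_bot : sqInv B ≫ sqBot B = sqBot B ≫ B.inv := sqLift_bot ..

theorem sqInv_top : sqInv B ≫ sqTop B = sqTop B ≫ B.inv := sqLift_top ..

theorem sqInv_tgt : sqInv B ≫ sqTgt B = sqSrc B := sqLift_tgt ..

/-- The structure maps of the groupoid of arrows: an arrow `f ⟶ f'` is a commutative square. -/
noncomputable abbrev arrowData : GroupoidData C where
  obj := B.arr
  arr := sq B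
  dom := sqSrc B
  cod := sqTgt B
  idn := sqIdn B
  comp := sqPaste B (pullback.fst (sqTgt B) (sqSrc B)) (pullback.snd (sqTgt B) (sqSrc B))
    pullback.condition
  inv := sqInv B

theorem arrowData_mul {X : C} (f g : X ⟶ sq B) (h : f ≫ sqTgt B = g ≫ sqSrc B) :
    (arrowData B).mul f g h = sqPaste B f g h := by
  change pullback.lift f g h ≫ sqPaste B (pullback.fst (sqTgt B) (sqSrc B))
    (pullback.snd (sqTgt B) (sqSrc B)) pullback.condition = _
  unfold sqPaste
  apply sq_ext <;>
    simp only [Category.assoc, sqLift_src, sqLift_bot, sqLift_top, sqLift_tgt, B.comp_mul,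
      pullback.lift_fst_assoc, pullback.lift_snd_assoc]

theorem sqPaste_src {X : C} (p q : X ⟶ sq B) (h : p ≫ sqTgt B = q ≫ sqSrc B) :
    sqPaste B p q h ≫ sqSrc B = p ≫ sqSrc B := sqLift_src ..

theorem sqPaste_tgt {X : C} (p q : X ⟶ sq B) (h : p ≫ sqTgt B = q ≫ sqSrc B) :
    sqPaste B p q h ≫ sqTgt B = q ≫ sqTgt B := sqLift_tgt ..

theorem sqPaste_bot {X : C} (p q : X ⟶ sq B) (h : p ≫ sqTgt B = q ≫ sqSrc B) :
    sqPaste B p q h ≫ sqBot B = B.mul (p ≫ sqBot B) (q ≫ sqBot B) (sq_comp_bot B h) :=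
  sqLift_bot ..

theorem sqPaste_top {X : C} (p q : X ⟶ sq B) (h : p ≫ sqTgt B = q ≫ sqSrc B) :
    sqPaste B p q h ≫ sqTop B = B.mul (p ≫ sqTop B) (q ≫ sqTop B) (sq_comp_top B h) :=
  sqLift_top ..

/-- The groupoid of arrows of `B` and commutative squares in `B`. -/
noncomputable abbrev arrowGroupoid : InternalGroupoid C where
  toGroupoidData := arrowData B
  idn_dom := sqIdn_src B
  idn_cod := sqIdn_tgt B
  comp_dom := sqPaste_src B _ _ pullback.condition
  comp_cod := sqPaste_tgt B _ _ pullback.condition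
  inv_dom := sqInv_src B
  inv_cod := sqInv_tgt B
  idn_mul := by
    refine (arrowData_mul B _ _ _).trans ?_
    apply sq_ext
    · rw [sqPaste_src]
      simp [arrowData, sqIdn_src]
    · rw [sqPaste_bot]
      refine (B.mul_congr (f' := (sqSrc B ≫ B.cod) ≫ B.idn) ?_ rfl _).trans (B.idn_mul' _ _ _)
      simp [arrowData, sqIdn_bot]
    · rw [sqPaste_top]
      refine (B.mul_congr (f' := (sqSrc B ≫ B.dom) ≫ B.idn) ?_ rfl _).trans (B.idn_mul' _ _ _)
      simp [arrowData, sqIdn_top]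
    · rw [sqPaste_tgt]
  mul_idn := by
    refine (arrowData_mul B _ _ _).trans ?_
    apply sq_ext
    · rw [sqPaste_src]
    · rw [sqPaste_bot]
      refine (B.mul_congr rfl (g' := (sqTgt B ≫ B.cod) ≫ B.idn) ?_ _).trans (B.mul_idn' _ _ _)
      simp [arrowData, sqIdn_bot]
    · rw [sqPaste_top]
      refine (B.mul_congr rfl (g' := (sqTgt B ≫ B.dom) ≫ B.idn) ?_ _).trans (B.mul_idn' _ _ _)
      simp [arrowData, sqIdn_top]
    · rw [sqPaste_tgt]
      simp [arrowData, sqIdn_tgt]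
  mul_inv := by
    refine (arrowData_mul B _ _ _).trans ?_
    apply sq_ext
    · rw [sqPaste_src]
      simp [arrowData, sqIdn_src]
    · rw [sqPaste_bot]
      refine (B.mul_congr (Category.id_comp _) (g' := sqBot B ≫ B.inv) (sqInv_bot B) _).trans ?_
      rw [B.mul_inv']
      simp only [arrowData, Category.assoc, sqIdn_bot]
      rw [← Category.assoc, ← sq_src_bot, Category.assoc]
    · rw [sqPaste_top]
      refine (B.mul_congr (Category.id_comp _) (g' := sqTop B ≫ B.inv) (sqInv_top B) _).trans ?_
      rw [B.mul_inv']
      simp only [arrowData, Category.assoc, sqIdn_top]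
      rw [← Category.assoc, sq_top_src, Category.assoc]
    · rw [sqPaste_tgt]
      simp [arrowData, sqIdn_tgt, sqInv_tgt]
  inv_mul := by
    refine (arrowData_mul B _ _ _).trans ?_
    apply sq_ext
    · rw [sqPaste_src]
      simp [arrowData, sqIdn_src, sqInv_src]
    · rw [sqPaste_bot]
      refine (B.mul_congr (f' := sqBot B ≫ B.inv) (sqInv_bot B) (Category.id_comp _) _).trans ?_
      rw [B.inv_mul']
      simp only [arrowData, Category.assoc, sqIdn_bot]
      rw [← Category.assoc, sq_bot_tgt, Category.assoc]
    · rw [sqPaste_top]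
      refine (B.mul_congr (f' := sqTop B ≫ B.inv) (sqInv_top B) (Category.id_comp _) _).trans ?_
      rw [B.inv_mul']
      simp only [arrowData, Category.assoc, sqIdn_top]
      rw [← Category.assoc, sq_top_tgt, Category.assoc]
    · rw [sqPaste_tgt]
      simp [arrowData, sqIdn_tgt]
  mul_assoc f g h hfg hgh := by
    refine (arrowData_mul B _ _ _).trans (Eq.trans ?_ (arrowData_mul B _ _ _).symm)
    have e1 : ((arrowData B).mul f g hfg) = sqPaste B f g hfg := arrowData_mul B f g hfg
    have e2 : ((arrowData B).mul g h hgh) = sqPaste B g h hgh := arrowData_mul B g h hgh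
    apply sq_ext
    · rw [sqPaste_src, sqPaste_src, e1, sqPaste_src]
    · rw [sqPaste_bot, sqPaste_bot]
      refine (B.mul_congr (by rw [e1, sqPaste_bot]) rfl _).trans (Eq.trans
        (B.mul_assoc _ _ _ (sq_comp_bot B hfg) (sq_comp_bot B hgh))
        (B.mul_congr rfl (by rw [e2, sqPaste_bot]) _).symm)
    · rw [sqPaste_top, sqPaste_top]
      refine (B.mul_congr (by rw [e1, sqPaste_top]) rfl _).trans (Eq.trans
        (B.mul_assoc _ _ _ (sq_comp_top B hfg) (sq_comp_top B hgh))
        (B.mul_congr rfl (by rw [e2, sqPaste_top]) _).symm)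
    · rw [sqPaste_tgt, sqPaste_tgt, e2, sqPaste_tgt]

/-- The domain functor `δ` from the groupoid of arrows. -/
noncomputable def arrowDom : InternalFunctor (arrowGroupoid B) B where
  map₀ := B.dom
  map₁ := sqTop B
  map_dom := sq_top_src B
  map_cod := sq_top_tgt B
  map_idn := sqIdn_top B
  map_comp := sqPaste_top B _ _ pullback.condition

/-- The codomain functor `γ` from the groupoid of arrows. -/
noncomputable def arrowCod : InternalFunctor (arrowGroupoid B) B where
  map₀ := B.cod
  map₁ := sqBot B
  map_dom := (sq_src_bot B).symm
  map_cod := sq_bot_tgt B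
  map_idn := sqIdn_bot B
  map_comp := sqPaste_bot B _ _ pullback.condition

/-- The universal natural transformation `β : δ ⇒ γ`, given by the identity of `B₁`. -/
noncomputable def arrowNat : InternalNatTrans (arrowDom B) (arrowCod B) where
  app := 𝟙 B.arr
  app_dom := Category.id_comp _
  app_cod := Category.id_comp _
  naturality := by
    refine (B.mul_congr rfl (Category.comp_id _) _).trans ((sq_comm B).symm.trans
      (B.mul_congr (Category.comp_id _) rfl _).symm)

/-- The functor into the groupoid of arrows corresponding to a natural transformation. -/
noncomputable def arrowLift {X B : InternalGroupoid C} {S T : InternalFunctor X B}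
    (μ : InternalNatTrans S T) : InternalFunctor X (arrowGroupoid B) where
  map₀ := μ.app
  map₁ := sqLift (X.dom ≫ μ.app) T.map₁ S.map₁ (X.cod ≫ μ.app)
    (by rw [Category.assoc, μ.app_cod, T.map_dom]) (by rw [S.map_cod, Category.assoc, μ.app_dom])
    μ.naturality.symm
  map_dom := sqLift_src ..
  map_cod := sqLift_tgt ..
  map_idn := by
    apply sq_ext
    · simp only [Category.assoc, sqLift_src, sqIdn_src]
      rw [← Category.assoc, X.idn_dom, Category.id_comp, Category.comp_id]
    · simp only [Category.assoc, sqLift_bot, sqIdn_bot]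
      rw [T.map_idn, ← Category.assoc, μ.app_cod]
    · simp only [Category.assoc, sqLift_top, sqIdn_top]
      rw [S.map_idn, ← Category.assoc, μ.app_dom]
    · simp only [Category.assoc, sqLift_tgt, sqIdn_tgt]
      rw [← Category.assoc, X.idn_cod, Category.id_comp, Category.comp_id]
  map_comp := by
    refine Eq.trans ?_ (arrowData_mul B _ _ _).symm
    apply sq_ext
    · rw [sqPaste_src]
      simp only [Category.assoc, sqLift_src]
      rw [← Category.assoc, X.comp_dom, Category.assoc]
    · rw [sqPaste_bot]
      simp only [Category.assoc, sqLift_bot]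
      exact T.map_comp
    · rw [sqPaste_top]
      simp only [Category.assoc, sqLift_top]
      exact S.map_comp
    · rw [sqPaste_tgt]
      simp only [Category.assoc, sqLift_tgt]
      rw [← Category.assoc, X.comp_cod, Category.assoc]

theorem arrowLift_top {X B : InternalGroupoid C} {S T : InternalFunctor X B}
    (μ : InternalNatTrans S T) : (arrowLift μ).map₁ ≫ sqTop B = S.map₁ :=
  sqLift_top _ _ _ _ _ _ μ.naturality.symm

theorem arrowLift_bot {X B : InternalGroupoid C} {S T : InternalFunctor X B}
    (μ : InternalNatTrans S T) : (arrowLift μ).map₁ ≫ sqBot B = T.map₁ :=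
  sqLift_bot _ _ _ _ _ _ μ.naturality.symm

end Arrow

end Basic

/-! ## Pointed base category: kernels, the strong h-kernel, `π₀` and `π₁` -/

section Pointed

variable {C : Type u} [Category.{v} C] [HasZeroMorphisms C] [HasFiniteLimits C]
  {A B : InternalGroupoid C}

theorem InternalGroupoid.mul_zero_zero (B : InternalGroupoid C) {X : C}
    (h : (0 : X ⟶ B.arr) ≫ B.cod = 0 ≫ B.dom) : B.mul 0 0 h = 0 := by
  refine (B.mul_congr (f' := (0 : X ⟶ B.obj) ≫ B.idn) zero_comp.symm rfl h).trans
    (B.idn_mul' 0 0 _)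

/-- The zero functor. -/
def zeroFunctor (A B : InternalGroupoid C) : InternalFunctor A B where
  map₀ := 0
  map₁ := 0
  map_dom := by rw [zero_comp, comp_zero]
  map_cod := by rw [zero_comp, comp_zero]
  map_idn := by rw [zero_comp, comp_zero]
  map_comp := by
    rw [comp_zero]
    exact ((B.mul_congr comp_zero comp_zero _).trans (B.mul_zero_zero _)).symm

section Kernel

variable (F : InternalFunctor A B)

noncomputable def kerDom : kernel F.map₁ ⟶ kernel F.map₀ :=
  kernel.lift _ (kernel.ι _ ≫ A.dom)
    (by rw [Category.assoc, ← F.map_dom, kernel.condition_assoc, zero_comp])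

noncomputable def kerCod : kernel F.map₁ ⟶ kernel F.map₀ :=
  kernel.lift _ (kernel.ι _ ≫ A.cod)
    (by rw [Category.assoc, ← F.map_cod, kernel.condition_assoc, zero_comp])

noncomputable def kerIdn : kernel F.map₀ ⟶ kernel F.map₁ :=
  kernel.lift _ (kernel.ι _ ≫ A.idn)
    (by rw [Category.assoc, F.map_idn, kernel.condition_assoc, zero_comp])

noncomputable def kerInv : kernel F.map₁ ⟶ kernel F.map₁ :=
  kernel.lift _ (kernel.ι _ ≫ A.inv)
    (by rw [Category.assoc, F.map_inv, kernel.condition_assoc, zero_comp])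

theorem kerDom_ι : kerDom F ≫ kernel.ι F.map₀ = kernel.ι F.map₁ ≫ A.dom := kernel.lift_ι _ _ _

theorem kerCod_ι : kerCod F ≫ kernel.ι F.map₀ = kernel.ι F.map₁ ≫ A.cod := kernel.lift_ι _ _ _

theorem kerIdn_ι : kerIdn F ≫ kernel.ι F.map₁ = kernel.ι F.map₀ ≫ A.idn := kernel.lift_ι _ _ _

theorem kerInv_ι : kerInv F ≫ kernel.ι F.map₁ = kernel.ι F.map₁ ≫ A.inv := kernel.lift_ι _ _ _

theorem ker_comm {X : C} {f g : X ⟶ kernel F.map₁} (h : f ≫ kerCod F = g ≫ kerDom F) :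
    (f ≫ kernel.ι F.map₁) ≫ A.cod = (g ≫ kernel.ι F.map₁) ≫ A.dom := by
  rw [Category.assoc, Category.assoc, ← kerCod_ι, ← kerDom_ι, ← Category.assoc, h,
    Category.assoc]

/-- Composition in the kernel is the restriction of composition in `A`. -/
noncomputable def kerComp : pullback (kerCod F) (kerDom F) ⟶ kernel F.map₁ :=
  kernel.lift _
    (A.mul (pullback.fst (kerCod F) (kerDom F) ≫ kernel.ι F.map₁)
      (pullback.snd (kerCod F) (kerDom F) ≫ kernel.ι F.map₁) (ker_comm F pullback.condition))
    (by
      rw [F.map_mul]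
      refine (B.mul_congr ?_ ?_ _).trans (B.mul_zero_zero (by rw [zero_comp, zero_comp]))
      · rw [Category.assoc, kernel.condition, comp_zero]
      · rw [Category.assoc, kernel.condition, comp_zero])

/-- The structure maps of the componentwise kernel of an internal functor. -/
noncomputable abbrev kernelData : GroupoidData C where
  obj := kernel F.map₀
  arr := kernel F.map₁
  dom := kerDom F
  cod := kerCod F
  idn := kerIdn F
  comp := kerComp F
  inv := kerInv F

theorem kerComp_ι : kerComp F ≫ kernel.ι F.map₁ =
    A.mul (pullback.fst (kerCod F) (kerDom F) ≫ kernel.ι F.map₁)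
      (pullback.snd (kerCod F) (kerDom F) ≫ kernel.ι F.map₁)
      (ker_comm F pullback.condition) := kernel.lift_ι _ _ _

theorem kernelData_mul_ι {X : C} (f g : X ⟶ kernel F.map₁) (h : f ≫ kerCod F = g ≫ kerDom F) :
    (kernelData F).mul f g h ≫ kernel.ι F.map₁ =
      A.mul (f ≫ kernel.ι F.map₁) (g ≫ kernel.ι F.map₁) (ker_comm F h) := by
  change (pullback.lift f g h ≫ kerComp F) ≫ _ = _
  rw [Category.assoc, kerComp_ι, A.comp_mul]
  exact A.mul_congr (by rw [pullback.lift_fst_assoc]) (by rw [pullback.lift_snd_assoc]) _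

theorem ker_ext {f : A.arr ⟶ B.arr} {X : C} {x y : X ⟶ kernel f}
    (h : x ≫ kernel.ι f = y ≫ kernel.ι f) : x = y := (cancel_mono _).1 h

/-- The (componentwise, strict) kernel `Ker(F)` of an internal functor. -/
noncomputable abbrev kernelGroupoid : InternalGroupoid C where
  toGroupoidData := kernelData F
  idn_dom := by
    rw [← cancel_mono (kernel.ι F.map₀), Category.assoc, kerDom_ι, ← Category.assoc, kerIdn_ι,
      Category.assoc, A.idn_dom, Category.comp_id, Category.id_comp]
  idn_cod := by
    rw [← cancel_mono (kernel.ι F.map₀), Category.assoc, kerCod_ι, ← Category.assoc, kerIdn_ι,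
      Category.assoc, A.idn_cod, Category.comp_id, Category.id_comp]
  comp_dom := by
    rw [← cancel_mono (kernel.ι F.map₀), Category.assoc, kerDom_ι, ← Category.assoc, kerComp_ι,
      A.mul_dom, Category.assoc, Category.assoc, kerDom_ι]
  comp_cod := by
    rw [← cancel_mono (kernel.ι F.map₀), Category.assoc, kerCod_ι, ← Category.assoc, kerComp_ι,
      A.mul_cod, Category.assoc, Category.assoc, kerCod_ι]
  inv_dom := by
    rw [← cancel_mono (kernel.ι F.map₀), Category.assoc, kerDom_ι, ← Category.assoc, kerInv_ι,
      Category.assoc, A.inv_dom, kerCod_ι]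
  inv_cod := by
    rw [← cancel_mono (kernel.ι F.map₀), Category.assoc, kerCod_ι, ← Category.assoc, kerInv_ι,
      Category.assoc, A.inv_cod, kerDom_ι]
  idn_mul := by
    apply ker_ext
    refine (kernelData_mul_ι F _ _ _).trans ?_
    refine (A.mul_congr (f' := (kernel.ι F.map₁ ≫ A.dom) ≫ A.idn) ?_ rfl _).trans
      (A.idn_mul' _ _ _)
    rw [Category.assoc, kerIdn_ι, ← Category.assoc, kerDom_ι]
  mul_idn := by
    apply ker_ext
    refine (kernelData_mul_ι F _ _ _).trans ?_
    refine (A.mul_congr rfl (g' := (kernel.ι F.map₁ ≫ A.cod) ≫ A.idn) ?_ _).trans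
      (A.mul_idn' _ _ _)
    rw [Category.assoc, kerIdn_ι, ← Category.assoc, kerCod_ι]
  mul_inv := by
    apply ker_ext
    refine (kernelData_mul_ι F _ _ _).trans ?_
    refine (A.mul_congr (Category.id_comp _) (kerInv_ι F) _).trans ((A.mul_inv' _ _).trans ?_)
    rw [Category.assoc, kerIdn_ι, ← Category.assoc, ← Category.assoc, kerDom_ι]
  inv_mul := by
    apply ker_ext
    refine (kernelData_mul_ι F _ _ _).trans ?_
    refine (A.mul_congr (kerInv_ι F) (Category.id_comp _) _).trans ((A.inv_mul' _ _).trans ?_)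
    rw [Category.assoc, kerIdn_ι, ← Category.assoc, ← Category.assoc, kerCod_ι]
  mul_assoc f g h hfg hgh := by
    apply ker_ext
    refine (kernelData_mul_ι F _ _ _).trans ?_
    refine (A.mul_congr (kernelData_mul_ι F _ _ _) rfl _).trans ?_
    refine Eq.trans ?_ (kernelData_mul_ι F _ _ _).symm
    refine Eq.trans ?_ (A.mul_congr rfl (kernelData_mul_ι F _ _ _) _).symm
    exact A.mul_assoc _ _ _ _ _

/-- The inclusion `K_F : Ker(F) ⟶ A`. -/
noncomputable def kernelι : InternalFunctor (kernelGroupoid F) A where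
  map₀ := kernel.ι F.map₀
  map₁ := kernel.ι F.map₁
  map_dom := (kerDom_ι F).symm
  map_cod := (kerCod_ι F).symm
  map_idn := kerIdn_ι F
  map_comp := kerComp_ι F

/-- The functor into the kernel induced by its universal property. -/
noncomputable def kernelLift {X : InternalGroupoid C} (T : InternalFunctor X A)
    (h₀ : T.map₀ ≫ F.map₀ = 0) (h₁ : T.map₁ ≫ F.map₁ = 0) :
    InternalFunctor X (kernelGroupoid F) where
  map₀ := kernel.lift _ T.map₀ h₀
  map₁ := kernel.lift _ T.map₁ h₁
  map_dom := by
    rw [← cancel_mono (kernel.ι F.map₀), Category.assoc, Category.assoc, kerDom_ι,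
      kernel.lift_ι, kernel.lift_ι_assoc, T.map_dom]
  map_cod := by
    rw [← cancel_mono (kernel.ι F.map₀), Category.assoc, Category.assoc, kerCod_ι,
      kernel.lift_ι, kernel.lift_ι_assoc, T.map_cod]
  map_idn := by
    rw [← cancel_mono (kernel.ι F.map₁), Category.assoc, Category.assoc, kerIdn_ι,
      kernel.lift_ι, kernel.lift_ι_assoc, T.map_idn]
  map_comp := by
    apply ker_ext
    refine Eq.trans ?_ (kernelData_mul_ι F _ _ _).symm
    refine Eq.trans ?_ (A.mul_congr (f' := pullback.fst X.cod X.dom ≫ T.map₁)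
      (g' := pullback.snd X.cod X.dom ≫ T.map₁) (by simp) (by simp) _).symm
    exact ((Category.assoc _ _ _).trans (congrArg (X.comp ≫ ·) (kernel.lift_ι _ _ _))).trans
      T.map_comp

end Kernel

section HKernel

variable (F : InternalFunctor A B)

/-- The functor to `B` whose pullback along `F` is the strong h-kernel: the restriction of the
codomain functor `γ` to the kernel of the domain functor `δ` of the groupoid of arrows of `B`. -/
noncomputable def pathCod : InternalFunctor (kernelGroupoid (arrowDom B)) B :=
  (kernelι (arrowDom B)).comp (arrowCod B)

/-- The strong h-kernel `𝕂(F)`: the limit of `0 ⟶ B ⟵ B⃗ ⟶ B ⟵ A`, where `B⃗` is the groupoid of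
arrows of `B`, with domain functor `B⃗ ⟶ B` on the left and codomain functor on the right. -/
noncomputable abbrev hKernel : InternalGroupoid C := pullbackGroupoid (pathCod (B := B)) F

/-- The projection `K(F) : 𝕂(F) ⟶ A`. -/
noncomputable def hKernelι : InternalFunctor (hKernel F) A := pullbackSnd pathCod F

/-- The canonical natural transformation `k(F) : 0 ⇒ K(F) · F`. -/
noncomputable def hKernelNat :
    InternalNatTrans (zeroFunctor (hKernel F) B) ((hKernelι F).comp F) where
  app := pullback.fst (pathCod (B := B)).map₀ F.map₀ ≫ kernel.ι (arrowDom B).map₀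
  app_dom := by
    refine (Category.assoc _ _ _).trans ?_
    exact (congrArg (pullback.fst (pathCod (B := B)).map₀ F.map₀ ≫ ·)
      (kernel.condition (arrowDom B).map₀)).trans comp_zero
  app_cod := (Category.assoc _ _ _).trans pullback.condition
  naturality := by
    let Φ : InternalFunctor (hKernel F) (arrowGroupoid B) :=
      (pullbackFst pathCod F).comp (kernelι (arrowDom B))
    have htop : Φ.map₁ ≫ sqTop B = 0 := (Category.assoc _ _ _).trans
      ((congrArg (pullback.fst (pathCod (B := B)).map₁ F.map₁ ≫ ·)
        (kernel.condition (arrowDom B).map₁)).trans comp_zero)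
    have hbot : Φ.map₁ ≫ sqBot B = pullback.snd (pathCod (B := B)).map₁ F.map₁ ≫ F.map₁ :=
      (Category.assoc _ _ _).trans pullback.condition
    have h := congrArg (Φ.map₁ ≫ ·) (sq_comm B)
    simp only [B.comp_mul] at h
    exact (B.mul_congr htop Φ.map_cod _).symm.trans (h.symm.trans (B.mul_congr Φ.map_dom hbot _))

/-- The functor into the strong h-kernel induced by its universal property: a functor `T` into `A`
together with a natural transformation `μ : 0 ⇒ T · F`. -/
noncomputable def hKernelLift {X : InternalGroupoid C} (T : InternalFunctor X A)
    (μ : InternalNatTrans (zeroFunctor X B) (T.comp F)) : InternalFunctor X (hKernel F) :=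
  pullbackLift (kernelLift (arrowDom B) (arrowLift μ) μ.app_dom (arrowLift_top μ)) T
    ((kernel.lift_ι_assoc _ _ _ _).trans μ.app_cod)
    ((kernel.lift_ι_assoc _ _ _ _).trans (arrowLift_bot μ))

/-- The identity natural transformation `0 ⇒ K_F · F`. -/
noncomputable def kernelNat :
    InternalNatTrans (zeroFunctor (kernelGroupoid F) B) ((kernelι F).comp F) where
  app := 0
  app_dom := zero_comp
  app_cod := zero_comp.trans (kernel.condition F.map₀).symm
  naturality := B.mul_congr comp_zero.symm (comp_zero.trans (kernel.condition F.map₁).symm) _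

/-- The canonical comparison `J : Ker(F) ⟶ 𝕂(F)`. -/
noncomputable def comparison : InternalFunctor (kernelGroupoid F) (hKernel F) :=
  hKernelLift F (kernelι F) (kernelNat F)

end HKernel

/-- `π₁(B)`, the joint kernel of the domain and the codomain. -/
noncomputable def π₁ (B : InternalGroupoid C) : C := kernel (prod.lift B.dom B.cod)

/-- The inclusion `ε : π₁(B) ⟶ B₁`. -/
noncomputable def π₁ι (B : InternalGroupoid C) : π₁ B ⟶ B.arr := kernel.ι (prod.lift B.dom B.cod)

theorem π₁ι_dom (B : InternalGroupoid C) : π₁ι B ≫ B.dom = 0 := by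
  have h := kernel.condition (prod.lift B.dom B.cod) =≫ prod.fst
  rwa [Category.assoc, prod.lift_fst, zero_comp] at h

theorem π₁ι_cod (B : InternalGroupoid C) : π₁ι B ≫ B.cod = 0 := by
  have h := kernel.condition (prod.lift B.dom B.cod) =≫ prod.snd
  rwa [Category.assoc, prod.lift_snd, zero_comp] at h

/-- The arrow `π₁(F)` induced by an internal functor. -/
noncomputable def π₁map (F : InternalFunctor A B) : π₁ A ⟶ π₁ B :=
  kernel.lift _ (π₁ι A ≫ F.map₁) (by
    apply Limits.prod.hom_ext
    · rw [Category.assoc, Category.assoc, prod.lift_fst, F.map_dom, ← Category.assoc, π₁ι_dom,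
        zero_comp, zero_comp]
    · rw [Category.assoc, Category.assoc, prod.lift_snd, F.map_cod, ← Category.assoc, π₁ι_cod,
        zero_comp, zero_comp])

/-- The arrow `Δ : π₁(B) ⟶ 𝕂(F)₀` determined by `Δ · k(F)₀ = ε` and `Δ · K(F)₀ = 0`. -/
noncomputable def snailΔ (F : InternalFunctor A B) : π₁ B ⟶ (hKernel F).obj :=
  pullback.lift (kernel.lift _ (π₁ι B) (π₁ι_dom B)) 0
    (by rw [zero_comp]; exact (kernel.lift_ι_assoc _ _ _ _).trans (π₁ι_cod B))

/-- Exactness of `f, g` at the middle object: `f · g = 0` and the factorization of `f` through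
the kernel of `g` is a regular epimorphism. -/
def IsExactAt {X Y Z : C} (f : X ⟶ Y) (g : Y ⟶ Z) : Prop :=
  ∃ w : f ≫ g = 0, IsRegularEpi (kernel.lift g f w)

end Pointed

section Components

variable {C : Type u} [Category.{v} C] [HasFiniteLimits C] [HasReflexiveCoequalizers C]
  {A B : InternalGroupoid C}

instance (B : InternalGroupoid C) : IsReflexivePair B.dom B.cod :=
  IsReflexivePair.mk' B.idn B.idn_dom B.idn_cod

/-- `π₀(B)`, the object of connected components. -/
noncomputable def π₀ (B : InternalGroupoid C) : C := coequalizer B.dom B.cod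

/-- The quotient `η : B₀ ⟶ π₀(B)`. -/
noncomputable def π₀π (B : InternalGroupoid C) : B.obj ⟶ π₀ B := coequalizer.π B.dom B.cod

theorem π₀π_condition (B : InternalGroupoid C) : B.dom ≫ π₀π B = B.cod ≫ π₀π B :=
  coequalizer.condition B.dom B.cod

/-- The arrow `π₀(F)` induced by an internal functor. -/
noncomputable def π₀map (F : InternalFunctor A B) : π₀ A ⟶ π₀ B :=
  coequalizer.desc (F.map₀ ≫ π₀π B) (by
    rw [← Category.assoc, ← Category.assoc, ← F.map_dom, ← F.map_cod, Category.assoc,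
      Category.assoc, π₀π_condition])

/-- A groupoid is proper if the factorization of `(d, c)` through the kernel pair of `η` is a
regular epimorphism. -/
def InternalGroupoid.IsProper (B : InternalGroupoid C) : Prop :=
  IsRegularEpi (pullback.lift B.dom B.cod (π₀π_condition B) : B.arr ⟶ pullback (π₀π B) (π₀π B))

/-- The connecting arrow `D : π₁(B) ⟶ π₀(𝕂(F))`. -/
noncomputable def snailD [HasZeroMorphisms C] (F : InternalFunctor A B) :
    π₁ B ⟶ π₀ (hKernel F) :=
  snailΔ F ≫ π₀π (hKernel F)

end Components

end IntGrpd

/-!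
In a regular category one may argue with generalized elements, provided that existence is read
locally: a regular epimorphism is an arrow along which generalized elements lift after passing to a
regular epimorphic cover (`exists_lift_of_isRegularEpi`, `isRegularEpi_of_lift`). Exactness becomes
such a lifting property (`isExactAt_of_exists_lift`), and so do properness
(`InternalGroupoid.IsProper.exists_arr`) and being a fibration
(`InternalFunctor.IsFibration.exists_lift`), so the argument is the one for ordinary groupoids.

An object of `𝕂(F)` is a pair `(β, a)` with `β : 0 ⟶ F(a)`, and an arrow `(β, a) ⟶ (β', a')` is an
arrow `α : a ⟶ a'` with `β · F(α) = β'` (`exists_hKernel_arr`, `hKernel_arr_mul`,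
`hKernel_arr_ext`). The comparison `J` sends `a` to `(0, a)`. It is fully
faithful, so `π₁(J)` is invertible and, by properness of `𝕂(F)`, `π₀(J)` is a monomorphism. If `F`
is a fibration, then lifting `β⁻¹ : F(a) ⟶ 0` to an arrow `a ⟶ a'` joins `(β, a)` to `J(a')`, so
`π₀(J)` is also a regular epimorphism. Hence `D` factors through `π₀(J)` as a unique `δ`.

Exactness at `π₁(A)` is formal. At `π₁(B)`, an arrow `(0, 0) ⟶ (β, 0)` of `𝕂(F)` is a loop of `A`
over `β`. At `π₀(Ker(F))`, an arrow `α : z ⟶ 0` of `A` gives the loop `F(α)`, whose image under `D`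
is the component of `J(z)`. At `π₀(A)`, an arrow `F(a) ⟶ 0` lifts to an arrow from `a` to an object
of `Ker(F)`.
-/

/-! ### Regular epimorphisms and generalized elements -/

namespace CategoryTheory.Regular

variable {C : Type u} [Category.{v} C] [Regular C]

theorem isRegularEpi_comp {X Y Z : C} (f : X ⟶ Y) (g : Y ⟶ Z) [IsRegularEpi f]
    [IsRegularEpi g] : IsRegularEpi (f ≫ g) := by
  have : StrongEpi (f ≫ g) := strongEpi_comp f g
  infer_instance

theorem isRegularEpi_of_comp {X Y Z : C} (f : X ⟶ Y) (g : Y ⟶ Z) [IsRegularEpi (f ≫ g)] :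
    IsRegularEpi g := by
  have : StrongEpi g := strongEpi_of_strongEpi f g
  infer_instance

/-- A generalized element of the target of a regular epimorphism lifts to the source after passing
to a regular epimorphic cover of its stage of definition. -/
theorem exists_lift_of_isRegularEpi {X Y T : C} (f : X ⟶ Y) [IsRegularEpi f] (y : T ⟶ Y) :
    ∃ (S : C) (p : S ⟶ T) (x : S ⟶ X), IsRegularEpi p ∧ x ≫ f = p ≫ y :=
  ⟨pullback f y, pullback.snd f y, pullback.fst f y, inferInstance, pullback.condition⟩

/-- Converse of `exists_lift_of_isRegularEpi`, tested on a single cover of the target. -/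
theorem isRegularEpi_of_lift {X Y T : C} {f : X ⟶ Y} {p : T ⟶ Y} (hp : IsRegularEpi p)
    (x : T ⟶ X) (h : x ≫ f = p) : IsRegularEpi f := by
  subst h
  exact isRegularEpi_of_comp x f

end CategoryTheory.Regular

namespace IntGrpd

open Regular

/-! ### Local lifting along a fibration -/

section Fibration

variable {C : Type u} [Category.{v} C] [Regular C] {A B : InternalGroupoid C}

/-- Fibrations lift arrows locally, with prescribed domain. -/
theorem InternalFunctor.IsFibration.exists_lift {F : InternalFunctor A B} (hF : F.IsFibration)
    {X : C} (a : X ⟶ A.obj) (b : X ⟶ B.arr) (h : a ≫ F.map₀ = b ≫ B.dom) :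
    ∃ (S : C) (p : S ⟶ X) (α : S ⟶ A.arr), IsRegularEpi p ∧ α ≫ A.dom = p ≫ a ∧
      α ≫ F.map₁ = p ≫ b := by
  have : IsRegularEpi (pullback.lift A.dom F.map₁ F.map_dom.symm) := hF
  obtain ⟨S, p, α, hp, hα⟩ := exists_lift_of_isRegularEpi
    (pullback.lift A.dom F.map₁ F.map_dom.symm) (pullback.lift a b h)
  refine ⟨S, p, α, hp, ?_, ?_⟩
  · simpa only [Category.assoc, pullback.lift_fst] using hα =≫ pullback.fst _ _
  · simpa only [Category.assoc, pullback.lift_snd] using hα =≫ pullback.snd _ _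

end Fibration

/-! ### Objects and arrows of the strong h-kernel -/

section HKernelElements

variable {C : Type u} [Category.{v} C] [HasZeroMorphisms C] [HasFiniteLimits C]
  {A B : InternalGroupoid C} (F : InternalFunctor A B) {X : C}

theorem hKernel_obj_ext {x y : X ⟶ (hKernel F).obj}
    (hβ : x ≫ (hKernelNat F).app = y ≫ (hKernelNat F).app)
    (ha : x ≫ (hKernelι F).map₀ = y ≫ (hKernelι F).map₀) : x = y := by
  apply pullback.hom_ext
  · rw [← cancel_mono (kernel.ι (arrowDom B).map₀)]
    exact (Category.assoc _ _ _).trans (hβ.trans (Category.assoc _ _ _).symm)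
  · exact ha

/-- A generalized object of the strong h-kernel is a pair `(β, a)` with `β : 0 ⟶ F(a)`, where
`β = x ≫ (hKernelNat F).app` and `a = x ≫ (hKernelι F).map₀`. -/
theorem hKernel_app_dom (x : X ⟶ (hKernel F).obj) :
    (x ≫ (hKernelNat F).app) ≫ B.dom = 0 := by
  rw [Category.assoc, (hKernelNat F).app_dom]
  exact comp_zero

theorem hKernel_app_cod (x : X ⟶ (hKernel F).obj) :
    (x ≫ (hKernelNat F).app) ≫ B.cod = (x ≫ (hKernelι F).map₀) ≫ F.map₀ := by
  rw [Category.assoc, (hKernelNat F).app_cod, Category.assoc]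
  rfl

theorem hKernel_arr_comm (g : X ⟶ (hKernel F).arr) :
    ((g ≫ (hKernel F).dom) ≫ (hKernelNat F).app) ≫ B.cod =
      ((g ≫ (hKernelι F).map₁) ≫ F.map₁) ≫ B.dom := by
  have h := congrArg (fun t => (g ≫ t) ≫ F.map₀) (hKernelι F).map_dom
  rw [hKernel_app_cod]
  simp only [Category.assoc, F.map_dom] at h ⊢
  exact h.symm

/-- An arrow `(β, a) ⟶ (β', a')` of the strong h-kernel lies over some `α : a ⟶ a'` with
`β · F(α) = β'`. -/
theorem hKernel_arr_mul (g : X ⟶ (hKernel F).arr) :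
    B.mul ((g ≫ (hKernel F).dom) ≫ (hKernelNat F).app) ((g ≫ (hKernelι F).map₁) ≫ F.map₁)
      (hKernel_arr_comm F g) = (g ≫ (hKernel F).cod) ≫ (hKernelNat F).app := by
  have h := congrArg (g ≫ ·) (hKernelNat F).naturality
  simp only [B.comp_mul] at h
  refine Eq.trans (B.mul_congr (Category.assoc _ _ _) (Category.assoc _ _ _) _)
    (h.symm.trans ?_)
  refine (B.mul_congr (f' := (0 : X ⟶ B.obj) ≫ B.idn) (comp_zero.trans zero_comp.symm)
    (Category.assoc _ _ _).symm _).trans (B.idn_mul' _ _ _)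

/-- The commutative square of `B` underlying an arrow of the strong h-kernel. -/
noncomputable def hKernelSq : (hKernel F).arr ⟶ sq B :=
  ((pullbackFst pathCod F).comp (kernelι (arrowDom B))).map₁

theorem hKernelSq_src : hKernelSq F ≫ sqSrc B = (hKernel F).dom ≫ (hKernelNat F).app :=
  ((pullbackFst pathCod F).comp (kernelι (arrowDom B))).map_dom

theorem hKernelSq_tgt : hKernelSq F ≫ sqTgt B = (hKernel F).cod ≫ (hKernelNat F).app :=
  ((pullbackFst pathCod F).comp (kernelι (arrowDom B))).map_cod

theorem hKernelSq_top : hKernelSq F ≫ sqTop B = 0 :=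
  (Category.assoc _ _ _).trans ((congrArg (pullback.fst (pathCod (B := B)).map₁ F.map₁ ≫ ·)
    (kernel.condition (arrowDom B).map₁)).trans comp_zero)

theorem hKernelSq_bot : hKernelSq F ≫ sqBot B = (hKernelι F).map₁ ≫ F.map₁ :=
  (Category.assoc _ _ _).trans pullback.condition

/-- An arrow of the strong h-kernel is determined by its domain and its image in `A`.
This makes `π₁(K(F))` a monomorphism. -/
theorem hKernel_arr_ext {g g' : X ⟶ (hKernel F).arr}
    (hd : g ≫ (hKernel F).dom = g' ≫ (hKernel F).dom)
    (hα : g ≫ (hKernelι F).map₁ = g' ≫ (hKernelι F).map₁) : g = g' := by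
  have hc : g ≫ (hKernel F).cod = g' ≫ (hKernel F).cod := by
    apply hKernel_obj_ext
    · rw [← hKernel_arr_mul, ← hKernel_arr_mul]
      exact B.mul_congr (by rw [hd]) (by rw [hα]) _
    · rw [Category.assoc, Category.assoc, ← (hKernelι F).map_cod, ← Category.assoc, hα,
        Category.assoc]
  apply pullback.hom_ext
  · rw [← cancel_mono (kernel.ι (arrowDom B).map₁)]
    refine (Category.assoc _ _ _).trans (Eq.trans (?_ : g ≫ hKernelSq F = g' ≫ hKernelSq F)
      (Category.assoc _ _ _).symm)
    apply sq_ext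
    · rw [Category.assoc, Category.assoc, hKernelSq_src, ← Category.assoc, hd, Category.assoc]
    · rw [Category.assoc, Category.assoc, hKernelSq_bot, ← Category.assoc, hα, Category.assoc]
    · rw [Category.assoc, Category.assoc, hKernelSq_top, comp_zero, comp_zero]
    · rw [Category.assoc, Category.assoc, hKernelSq_tgt, ← Category.assoc, hc, Category.assoc]
  · exact hα

/-- Every `α : a ⟶ a'` with `β · F(α) = β'` underlies an arrow `(β, a) ⟶ (β', a')` of the strong
h-kernel. -/
theorem exists_hKernel_arr (x y : X ⟶ (hKernel F).obj) (α : X ⟶ A.arr)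
    (hd : α ≫ A.dom = x ≫ (hKernelι F).map₀) (hc : α ≫ A.cod = y ≫ (hKernelι F).map₀)
    (h : (x ≫ (hKernelNat F).app) ≫ B.cod = (α ≫ F.map₁) ≫ B.dom)
    (hm : B.mul (x ≫ (hKernelNat F).app) (α ≫ F.map₁) h = y ≫ (hKernelNat F).app) :
    ∃ g : X ⟶ (hKernel F).arr, g ≫ (hKernel F).dom = x ∧ g ≫ (hKernel F).cod = y := by
  have ht : (0 : X ⟶ B.arr) ≫ B.cod = (y ≫ (hKernelNat F).app) ≫ B.dom := by
    rw [hKernel_app_dom, zero_comp]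
  have hsq : B.mul (x ≫ (hKernelNat F).app) (α ≫ F.map₁) h =
      B.mul 0 (y ≫ (hKernelNat F).app) ht := by
    rw [hm]
    exact ((B.mul_congr (f' := (0 : X ⟶ B.obj) ≫ B.idn) zero_comp.symm rfl ht).trans
      (B.idn_mul' _ _ _)).symm
  let s : X ⟶ sq B := sqLift _ _ _ _ h ht hsq
  have hs : s ≫ (arrowDom B).map₁ = 0 := sqLift_top ..
  let g : X ⟶ (hKernel F).arr := pullback.lift (kernel.lift _ s hs) α
    ((kernel.lift_ι_assoc _ _ _ _).trans (sqLift_bot ..))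
  have hg : g ≫ hKernelSq F = s :=
    (pullback.lift_fst_assoc _ _ _ _).trans (kernel.lift_ι _ _ _)
  refine ⟨g, ?_, ?_⟩
  · apply hKernel_obj_ext
    · rw [Category.assoc, ← hKernelSq_src, ← Category.assoc, hg]
      exact sqLift_src ..
    · rw [Category.assoc, ← (hKernelι F).map_dom, ← hd, ← Category.assoc]
      congr 1
      exact pullback.lift_snd _ _ _
  · apply hKernel_obj_ext
    · rw [Category.assoc, ← hKernelSq_tgt, ← Category.assoc, hg]
      exact sqLift_tgt ..
    · rw [Category.assoc, ← (hKernelι F).map_cod, ← hc, ← Category.assoc]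
      congr 1
      exact pullback.lift_snd _ _ _

theorem comparison_comp_hKernelι : (comparison F).comp (hKernelι F) = kernelι F :=
  InternalFunctor.ext (pullback.lift_snd _ _ _) (pullback.lift_snd _ _ _)

theorem comparison_app : (comparison F).map₀ ≫ (hKernelNat F).app = 0 :=
  (pullback.lift_fst_assoc _ _ _ _).trans (kernel.lift_ι _ _ _)

theorem comparison_map₀ : (comparison F).map₀ ≫ (hKernelι F).map₀ = kernel.ι F.map₀ :=
  pullback.lift_snd _ _ _

theorem comp_comparison_app (z : X ⟶ (kernelGroupoid F).obj) :
    (z ≫ (comparison F).map₀) ≫ (hKernelNat F).app = 0 :=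
  (Category.assoc _ _ _).trans ((congrArg (z ≫ ·) (comparison_app F)).trans comp_zero)

theorem comp_comparison_map₀ (z : X ⟶ (kernelGroupoid F).obj) :
    (z ≫ (comparison F).map₀) ≫ (hKernelι F).map₀ = z ≫ kernel.ι F.map₀ :=
  (Category.assoc _ _ _).trans (congrArg (z ≫ ·) (comparison_map₀ F))

theorem snailΔ_app : snailΔ F ≫ (hKernelNat F).app = π₁ι B :=
  (pullback.lift_fst_assoc _ _ _ _).trans (kernel.lift_ι _ _ _)

theorem snailΔ_map₀ : snailΔ F ≫ (hKernelι F).map₀ = 0 :=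
  pullback.lift_snd _ _ _

end HKernelElements

/-! ### Functoriality of `π₁` and the comparison on loops -/

section LoopObject

variable {C : Type u} [Category.{v} C] [HasZeroMorphisms C] [HasFiniteLimits C]
  {A B D : InternalGroupoid C}

instance (B : InternalGroupoid C) : Mono (π₁ι B) :=
  inferInstanceAs (Mono (kernel.ι _))

theorem π₁map_ι (F : InternalFunctor A B) : π₁map F ≫ π₁ι B = π₁ι A ≫ F.map₁ :=
  kernel.lift_ι _ _ _

theorem π₁map_comp (F : InternalFunctor A B) (G : InternalFunctor B D) :
    π₁map (F.comp G) = π₁map F ≫ π₁map G := by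
  rw [← cancel_mono (π₁ι D), Category.assoc, π₁map_ι, π₁map_ι, ← Category.assoc, π₁map_ι,
    Category.assoc]
  rfl

theorem exists_π₁_lift {X : C} (f : X ⟶ B.arr) (hd : f ≫ B.dom = 0) (hc : f ≫ B.cod = 0) :
    ∃ g : X ⟶ π₁ B, g ≫ π₁ι B = f :=
  ⟨kernel.lift _ f (by
    apply Limits.prod.hom_ext
    · rw [Category.assoc, prod.lift_fst, hd, zero_comp]
    · rw [Category.assoc, prod.lift_snd, hc, zero_comp]), kernel.lift_ι _ _ _⟩

/-- `π₁(K_F)` is a kernel of `π₁(F)`: a loop of `A` killed by `F` lifts to `Ker(F)`. -/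
theorem exists_π₁_kernel_lift (F : InternalFunctor A B) {X : C} (f : X ⟶ π₁ A)
    (hf : (f ≫ π₁ι A) ≫ F.map₁ = 0) : ∃ g, g ≫ π₁map (kernelι F) = f := by
  obtain ⟨g, hg⟩ := exists_π₁_lift (B := kernelGroupoid F) (kernel.lift _ (f ≫ π₁ι A) hf)
    (by
      rw [← cancel_mono (kernel.ι F.map₀), Category.assoc, kerDom_ι, kernel.lift_ι_assoc,
        Category.assoc, π₁ι_dom, comp_zero, zero_comp])
    (by
      rw [← cancel_mono (kernel.ι F.map₀), Category.assoc, kerCod_ι, kernel.lift_ι_assoc,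
        Category.assoc, π₁ι_cod, comp_zero, zero_comp])
  refine ⟨g, ?_⟩
  rw [← cancel_mono (π₁ι A), Category.assoc, π₁map_ι, ← Category.assoc, hg]
  exact kernel.lift_ι _ _ _

instance mono_π₁map_kernelι (F : InternalFunctor A B) : Mono (π₁map (kernelι F)) := by
  have : Mono (π₁map (kernelι F) ≫ π₁ι A) := by
    rw [π₁map_ι]
    have : Mono (kernelι F).map₁ := inferInstanceAs (Mono (kernel.ι _))
    infer_instance
  exact mono_of_mono _ (π₁ι A)

instance mono_π₁map_hKernelι (F : InternalFunctor A B) : Mono (π₁map (hKernelι F)) where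
  right_cancellation {Z} f g h := by
    rw [← cancel_mono (π₁ι (hKernel F))]
    apply hKernel_arr_ext
    · rw [Category.assoc, Category.assoc, π₁ι_dom, comp_zero, comp_zero]
    · have h' := congrArg (· ≫ π₁ι A) h
      simpa only [Category.assoc, π₁map_ι] using h'

/-- An automorphism of `(0, 0)` in the strong h-kernel lies over an `α` with `0 · F(α) = 0`. -/
theorem π₁map_hKernelι_map₁ (F : InternalFunctor A B) :
    (π₁map (hKernelι F) ≫ π₁ι A) ≫ F.map₁ = 0 := by
  have h := hKernel_arr_mul F (π₁ι (hKernel F))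
  rw [π₁map_ι]
  have e (x : π₁ (hKernel F) ⟶ (hKernel F).obj) (hx : x = 0) : x ≫ (hKernelNat F).app =
      (0 : _ ⟶ B.obj) ≫ B.idn := by rw [hx, zero_comp, zero_comp]
  have h0 := e _ (π₁ι_dom (hKernel F))
  have h1 := e _ (π₁ι_cod (hKernel F))
  rw [h1, B.mul_congr h0 rfl, B.idn_mul', zero_comp] at h
  exact h

/-- `π₁(J)` is an isomorphism for every functor `F`: both `π₁(K_F)` and `π₁(K(F))` are
monomorphisms onto the loops of `A` killed by `F`. -/
theorem isIso_π₁map_comparison (F : InternalFunctor A B) : IsIso (π₁map (comparison F)) := by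
  have hJ : π₁map (comparison F) ≫ π₁map (hKernelι F) = π₁map (kernelι F) := by
    rw [← π₁map_comp, comparison_comp_hKernelι]
  obtain ⟨s, hs⟩ := exists_π₁_kernel_lift F (π₁map (hKernelι F)) (π₁map_hKernelι_map₁ F)
  refine ⟨s, ?_, ?_⟩
  · rw [← cancel_mono (π₁map (kernelι F)), Category.assoc, hs, hJ, Category.id_comp]
  · rw [← cancel_mono (π₁map (hKernelι F)), Category.assoc, hJ, hs, Category.id_comp]

end LoopObject

/-! ### Connected components and local connectedness by arrows -/

section Components

variable {C : Type u} [Category.{v} C] [Regular C] [HasReflexiveCoequalizers C]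
  {A B D : InternalGroupoid C}

instance (B : InternalGroupoid C) : IsRegularEpi (π₀π B) :=
  inferInstanceAs (IsRegularEpi (coequalizer.π _ _))

theorem π₀π_map (F : InternalFunctor A B) : π₀π A ≫ π₀map F = F.map₀ ≫ π₀π B :=
  coequalizer.π_desc _ _

theorem π₀map_comp (F : InternalFunctor A B) (G : InternalFunctor B D) :
    π₀map (F.comp G) = π₀map F ≫ π₀map G := by
  rw [← cancel_epi (π₀π A), π₀π_map, ← Category.assoc, π₀π_map, Category.assoc, π₀π_map,
    ← Category.assoc]
  rfl

theorem InternalGroupoid.π₀π_eq_of_arr (B : InternalGroupoid C) {X : C} (g : X ⟶ B.arr) :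
    (g ≫ B.dom) ≫ π₀π B = (g ≫ B.cod) ≫ π₀π B := by
  rw [Category.assoc, Category.assoc, π₀π_condition]

/-- In a proper groupoid, two generalized objects in the same component are locally joined by an
arrow. -/
theorem InternalGroupoid.IsProper.exists_arr {B : InternalGroupoid C} (hB : B.IsProper) {X : C}
    (x y : X ⟶ B.obj) (h : x ≫ π₀π B = y ≫ π₀π B) :
    ∃ (S : C) (p : S ⟶ X) (g : S ⟶ B.arr), IsRegularEpi p ∧ g ≫ B.dom = p ≫ x ∧
      g ≫ B.cod = p ≫ y := by
  have : IsRegularEpi (pullback.lift B.dom B.cod (π₀π_condition B)) := hB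
  obtain ⟨S, p, g, hp, hg⟩ := exists_lift_of_isRegularEpi
    (pullback.lift B.dom B.cod (π₀π_condition B)) (pullback.lift x y h)
  refine ⟨S, p, g, hp, ?_, ?_⟩
  · simpa only [Category.assoc, pullback.lift_fst] using hg =≫ pullback.fst _ _
  · simpa only [Category.assoc, pullback.lift_snd] using hg =≫ pullback.snd _ _

end Components

/-! ### The comparison on components and exactness -/

section Exactness

variable {C : Type u} [Category.{v} C] [HasZeroMorphisms C] [Regular C]

/-- Exactness is a local lifting property of generalized elements of the kernel. -/
theorem isExactAt_of_exists_lift {X Y Z : C} {f : X ⟶ Y} {g : Y ⟶ Z} (w : f ≫ g = 0)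
    (h : ∀ {T : C} (y : T ⟶ Y), y ≫ g = 0 →
      ∃ (S : C) (p : S ⟶ T) (x : S ⟶ X), IsRegularEpi p ∧ x ≫ f = p ≫ y) : IsExactAt f g := by
  obtain ⟨S, p, x, hp, hx⟩ := h (kernel.ι g) (kernel.condition g)
  refine ⟨w, isRegularEpi_of_lift hp x ?_⟩
  rw [← cancel_mono (kernel.ι g), Category.assoc, kernel.lift_ι, hx]

theorem IsExactAt.of_comp_mono {X Y Z W : C} {f : X ⟶ Y} {g : Y ⟶ Z} (i : Z ⟶ W) [Mono i]
    (h : IsExactAt f (g ≫ i)) : IsExactAt f g := by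
  obtain ⟨w, hr⟩ := h
  refine isExactAt_of_exists_lift ?_ fun y hy => ?_
  · rw [← cancel_mono i, Category.assoc, w, zero_comp]
  · obtain ⟨S, p, x, hp, hx⟩ := exists_lift_of_isRegularEpi (kernel.lift (g ≫ i) f w)
      (kernel.lift (g ≫ i) y (by rw [← Category.assoc, hy, zero_comp]))
    refine ⟨S, p, x, hp, ?_⟩
    simpa only [Category.assoc, kernel.lift_ι] using hx =≫ kernel.ι (g ≫ i)

variable {A B : InternalGroupoid C} (F : InternalFunctor A B)

theorem isExactAt_π₁map_kernelι : IsExactAt (π₁map (kernelι F)) (π₁map F) := by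
  refine isExactAt_of_exists_lift ?_ fun {T} y hy => ?_
  · rw [← cancel_mono (π₁ι B), Category.assoc, π₁map_ι, ← Category.assoc, π₁map_ι,
      Category.assoc, zero_comp]
    exact (congrArg (π₁ι (kernelGroupoid F) ≫ ·) (kernel.condition F.map₁)).trans comp_zero
  · obtain ⟨x, hx⟩ := exists_π₁_kernel_lift F y (by
      rw [Category.assoc, ← π₁map_ι, ← Category.assoc, hy, zero_comp])
    exact ⟨T, 𝟙 T, x, inferInstance, by rw [hx, Category.id_comp]⟩

variable [HasReflexiveCoequalizers C] {F} {X : C}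

theorem comp_comparison_π₀π (z : X ⟶ (kernelGroupoid F).obj) :
    (z ≫ (comparison F).map₀) ≫ π₀π (hKernel F) =
      (z ≫ π₀π (kernelGroupoid F)) ≫ π₀map (comparison F) := by
  rw [Category.assoc, ← π₀π_map, Category.assoc]

/-- If `α : a ⟶ a'` satisfies `F(α) = β⁻¹`, then `F(a') = 0` and `α` underlies an arrow
`(β, a) ⟶ (0, a') = J(a')` of the strong h-kernel. -/
theorem hKernel_π₀π_eq_comparison (x : X ⟶ (hKernel F).obj) (α : X ⟶ A.arr)
    (hd : α ≫ A.dom = x ≫ (hKernelι F).map₀)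
    (hα : α ≫ F.map₁ = (x ≫ (hKernelNat F).app) ≫ B.inv)
    (z : X ⟶ (kernelGroupoid F).obj) (hz : z ≫ kernel.ι F.map₀ = α ≫ A.cod) :
    x ≫ π₀π (hKernel F) = (z ≫ π₀π (kernelGroupoid F)) ≫ π₀map (comparison F) := by
  have h : (x ≫ (hKernelNat F).app) ≫ B.cod = (α ≫ F.map₁) ≫ B.dom := by
    rw [hα, Category.assoc _ B.inv, B.inv_dom]
  obtain ⟨g, hgd, hgc⟩ := exists_hKernel_arr F x (z ≫ (comparison F).map₀) α hd
    (by rw [comp_comparison_map₀, hz]) h (by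
      rw [comp_comparison_app, B.mul_congr rfl hα, B.mul_inv', ← Category.assoc,
        hKernel_app_dom, zero_comp])
  rw [← comp_comparison_π₀π, ← hgd, ← hgc]
  exact (hKernel F).π₀π_eq_of_arr g

/-- `J` is full: an arrow `J(z) ⟶ J(z')` lies over some `α : z ⟶ z'` with `F(α) = 0`. -/
theorem kernel_π₀π_eq_of_hKernel_arr (z z' : X ⟶ (kernelGroupoid F).obj)
    (g : X ⟶ (hKernel F).arr) (hd : g ≫ (hKernel F).dom = z ≫ (comparison F).map₀)
    (hc : g ≫ (hKernel F).cod = z' ≫ (comparison F).map₀) :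
    z ≫ π₀π (kernelGroupoid F) = z' ≫ π₀π (kernelGroupoid F) := by
  have hα : (g ≫ (hKernelι F).map₁) ≫ F.map₁ = 0 := by
    have h := hKernel_arr_mul F g
    rw [B.mul_congr (f' := (0 : X ⟶ B.obj) ≫ B.idn)
      (by rw [hd, comp_comparison_app, zero_comp]) rfl, B.idn_mul', hc, comp_comparison_app] at h
    exact h
  have key := (kernelGroupoid F).π₀π_eq_of_arr (kernel.lift _ _ hα)
  have e1 : kernel.lift _ _ hα ≫ (kernelGroupoid F).dom = z := by
    rw [← cancel_mono (kernel.ι F.map₀), Category.assoc, kerDom_ι, kernel.lift_ι_assoc,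
      Category.assoc, (hKernelι F).map_dom, ← Category.assoc, hd, comp_comparison_map₀]
  have e2 : kernel.lift _ _ hα ≫ (kernelGroupoid F).cod = z' := by
    rw [← cancel_mono (kernel.ι F.map₀), Category.assoc, kerCod_ι, kernel.lift_ι_assoc,
      Category.assoc, (hKernelι F).map_cod, ← Category.assoc, hc, comp_comparison_map₀]
  rwa [e1, e2] at key

/-- For a fibration, `J` is locally essentially surjective: lifting `β⁻¹` along `F` joins `(β, a)`
to an object of `Ker(F)`. -/
theorem InternalFunctor.IsFibration.isRegularEpi_π₀map_comparison (hF : F.IsFibration) :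
    IsRegularEpi (π₀map (comparison F)) := by
  obtain ⟨S, p, α, hp, hd, hα⟩ := hF.exists_lift (hKernelι F).map₀ ((hKernelNat F).app ≫ B.inv)
    (by rw [Category.assoc, B.inv_dom]; exact (hKernelNat F).app_cod.symm)
  have hz : (α ≫ A.cod) ≫ F.map₀ = 0 := by
    rw [Category.assoc, ← F.map_cod, ← Category.assoc, hα, Category.assoc, Category.assoc,
      B.inv_cod, (hKernelNat F).app_dom]
    exact comp_zero
  have h := hKernel_π₀π_eq_comparison p α hd (by rw [hα, Category.assoc])
    (kernel.lift _ _ hz) (kernel.lift_ι _ _ _)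
  exact isRegularEpi_of_lift (isRegularEpi_comp p (π₀π (hKernel F))) _ h.symm

theorem mono_π₀map_comparison (hK : (hKernel F).IsProper) : Mono (π₀map (comparison F)) where
  right_cancellation {Z} u v h := by
    obtain ⟨S₁, p₁, x, hp₁, hx⟩ := exists_lift_of_isRegularEpi (π₀π (kernelGroupoid F)) u
    obtain ⟨S₂, p₂, y, hp₂, hy⟩ := exists_lift_of_isRegularEpi (π₀π (kernelGroupoid F)) (p₁ ≫ v)
    obtain ⟨S₃, p₃, g, hp₃, hd, hc⟩ := hK.exists_arr ((p₂ ≫ x) ≫ (comparison F).map₀)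
      (y ≫ (comparison F).map₀) (by
        rw [comp_comparison_π₀π, comp_comparison_π₀π, hy]
        simp only [Category.assoc, reassoc_of% hx, h])
    have key := kernel_π₀π_eq_of_hKernel_arr (p₃ ≫ p₂ ≫ x) (p₃ ≫ y) g
      (by simp only [hd, Category.assoc]) (by simp only [hc, Category.assoc])
    rw [← cancel_epi p₁, ← cancel_epi p₂, ← cancel_epi p₃]
    simpa only [Category.assoc, hx, hy] using key

theorem isIso_π₀map_comparison (hF : F.IsFibration) (hK : (hKernel F).IsProper) :
    IsIso (π₀map (comparison F)) := by
  have := mono_π₀map_comparison hK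
  have := hF.isRegularEpi_π₀map_comparison
  exact isIso_of_mono_of_strongEpi _

theorem isExactAt_π₁map_snailD (hK : (hKernel F).IsProper) :
    IsExactAt (π₁map F) (snailD F) := by
  refine isExactAt_of_exists_lift ?_ fun {T} y hy => ?_
  -- A loop `α` of `A` underlies an arrow `(0, 0) ⟶ (F(α), 0)` of the strong h-kernel.
  · obtain ⟨g, hgd, hgc⟩ := exists_hKernel_arr F (0 : π₁ A ⟶ _) (π₁map F ≫ snailΔ F) (π₁ι A)
      (by rw [π₁ι_dom, zero_comp]) (by rw [π₁ι_cod, Category.assoc, snailΔ_map₀, comp_zero])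
      (by rw [zero_comp, zero_comp, Category.assoc, F.map_dom, ← Category.assoc, π₁ι_dom,
        zero_comp])
      (by
        rw [B.mul_congr (f' := (0 : _ ⟶ B.obj) ≫ B.idn) (by rw [zero_comp, zero_comp]) rfl,
          B.idn_mul', Category.assoc, snailΔ_app, π₁map_ι])
    rw [snailD, ← Category.assoc, ← hgc, ← (hKernel F).π₀π_eq_of_arr, hgd, zero_comp]
  -- Conversely an arrow `(0, 0) ⟶ (y, 0)` lies over a loop `α` of `A` with `F(α) = y`.
  · obtain ⟨S, p, g, hp, hd, hc⟩ := hK.exists_arr 0 (y ≫ snailΔ F)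
      (by rw [zero_comp, Category.assoc]; exact hy.symm)
    have hm := hKernel_arr_mul F g
    rw [B.mul_congr (f' := (0 : _ ⟶ B.obj) ≫ B.idn)
      (by rw [hd, comp_zero, zero_comp, zero_comp]) rfl, B.idn_mul', hc, Category.assoc,
      Category.assoc, Category.assoc, snailΔ_app] at hm
    obtain ⟨x, hx⟩ := exists_π₁_lift (g ≫ (hKernelι F).map₁)
      (by rw [Category.assoc, (hKernelι F).map_dom, ← Category.assoc, hd, comp_zero, zero_comp])
      (by rw [Category.assoc, (hKernelι F).map_cod, ← Category.assoc, hc, Category.assoc,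
        Category.assoc, snailΔ_map₀, comp_zero, comp_zero])
    refine ⟨S, p, x, hp, ?_⟩
    rw [← cancel_mono (π₁ι B), Category.assoc, π₁map_ι, ← Category.assoc, hx, Category.assoc, hm,
      Category.assoc]

/-- If `[z]` in `π₀(Ker(F))` becomes trivial in `π₀(A)`, there is locally an arrow `α : z ⟶ 0`, and
`F(α)` is a loop of `B` sent by `D` to `[J(z)]`, since `α⁻¹` underlies an arrow
`(F(α), 0) ⟶ (0, z)` of the strong h-kernel. -/
theorem exists_snailD_lift (hA : A.IsProper) {T : C} (u : T ⟶ π₀ (kernelGroupoid F))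
    (hu : u ≫ π₀map (kernelι F) = 0) : ∃ (S : C) (p : S ⟶ T) (b : S ⟶ π₁ B), IsRegularEpi p ∧
      b ≫ snailD F = p ≫ u ≫ π₀map (comparison F) := by
  obtain ⟨S, p, z, hp, hz⟩ := exists_lift_of_isRegularEpi (π₀π (kernelGroupoid F)) u
  obtain ⟨R, q, α, hq, hd, hc⟩ := hA.exists_arr (z ≫ kernel.ι F.map₀) 0 (by
    have h := hz =≫ π₀map (kernelι F)
    rw [Category.assoc, Category.assoc, hu, π₀π_map, comp_zero] at h
    rw [zero_comp, Category.assoc]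
    exact h)
  obtain ⟨b, hb⟩ := exists_π₁_lift (α ≫ F.map₁)
    (by rw [Category.assoc, F.map_dom, ← Category.assoc, hd, Category.assoc, Category.assoc,
      kernel.condition, comp_zero, comp_zero])
    (by rw [Category.assoc, F.map_cod, ← Category.assoc, hc, comp_zero, zero_comp])
  refine ⟨R, q ≫ p, b, isRegularEpi_comp q p, ?_⟩
  rw [snailD, ← Category.assoc, hKernel_π₀π_eq_comparison (b ≫ snailΔ F) (α ≫ A.inv)
    (by rw [Category.assoc, A.inv_dom, hc, Category.assoc, snailΔ_map₀, comp_zero, comp_zero])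
    (by rw [Category.assoc, F.map_inv, Category.assoc b, snailΔ_app, hb, Category.assoc])
    (q ≫ z) (by rw [Category.assoc, Category.assoc, A.inv_cod, hd])]
  simp only [Category.assoc, reassoc_of% hz]

theorem isExactAt_π₀map_kernelι (hF : F.IsFibration) (hB : B.IsProper) :
    IsExactAt (π₀map (kernelι F)) (π₀map F) := by
  refine isExactAt_of_exists_lift ?_ fun {T} u hu => ?_
  · rw [← cancel_epi (π₀π (kernelGroupoid F)), ← Category.assoc, π₀π_map, Category.assoc,
      π₀π_map, comp_zero]
    exact (kernel.condition_assoc _ _).trans zero_comp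
  · obtain ⟨S, p, a, hp, ha⟩ := exists_lift_of_isRegularEpi (π₀π A) u
    obtain ⟨R, q, b, hq, hd, hc⟩ := hB.exists_arr (a ≫ F.map₀) 0 (by
      rw [zero_comp, Category.assoc, ← π₀π_map, ← Category.assoc, ha, Category.assoc, hu,
        comp_zero])
    -- Lifting `b : F(a) ⟶ 0` along the fibration moves `a` into `Ker(F)` within its component.
    obtain ⟨Q, r, α, hr, hαd, hα⟩ := hF.exists_lift (q ≫ a) b (by rw [hd, Category.assoc])
    have hz : (α ≫ A.cod) ≫ F.map₀ = 0 := by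
      rw [Category.assoc, ← F.map_cod, ← Category.assoc, hα, Category.assoc, hc, comp_zero,
        comp_zero]
    have := isRegularEpi_comp q p
    refine ⟨Q, r ≫ q ≫ p, kernel.lift _ _ hz ≫ π₀π (kernelGroupoid F), isRegularEpi_comp r _, ?_⟩
    rw [Category.assoc, π₀π_map]
    refine (kernel.lift_ι_assoc _ _ _ _).trans ?_
    rw [← A.π₀π_eq_of_arr, hαd]
    simp only [Category.assoc, ha]

end Exactness

end IntGrpd

theorem mainTheorem2 {C : Type u} [Category.{v} C] [HasZeroObject C] [HasZeroMorphisms C]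
    [Regular C] [HasReflexiveCoequalizers C]
    {A B : IntGrpd.InternalGroupoid C} (F : IntGrpd.InternalFunctor A B)
    (hF : F.IsFibration) (hA : A.IsProper) (hB : B.IsProper)
    (hK : (IntGrpd.hKernel F).IsProper) :
    IsIso (IntGrpd.π₁map (IntGrpd.comparison F)) ∧
    IsIso (IntGrpd.π₀map (IntGrpd.comparison F)) ∧
    IntGrpd.π₁map (IntGrpd.comparison F) ≫ IntGrpd.π₁map (IntGrpd.hKernelι F) =
      IntGrpd.π₁map (IntGrpd.kernelι F) ∧
    IntGrpd.π₀map (IntGrpd.comparison F) ≫ IntGrpd.π₀map (IntGrpd.hKernelι F) =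
      IntGrpd.π₀map (IntGrpd.kernelι F) ∧
    ∃ δ : IntGrpd.π₁ B ⟶ IntGrpd.π₀ (IntGrpd.kernelGroupoid F),
      δ ≫ IntGrpd.π₀map (IntGrpd.comparison F) = IntGrpd.snailD F ∧
      IntGrpd.IsExactAt (IntGrpd.π₁map (IntGrpd.kernelι F)) (IntGrpd.π₁map F) ∧
      IntGrpd.IsExactAt (IntGrpd.π₁map F) δ ∧
      IntGrpd.IsExactAt δ (IntGrpd.π₀map (IntGrpd.kernelι F)) ∧
      IntGrpd.IsExactAt (IntGrpd.π₀map (IntGrpd.kernelι F)) (IntGrpd.π₀map F) := by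
  have hJ := IntGrpd.isIso_π₀map_comparison hF hK
  have hπ₁ : IntGrpd.π₁map (IntGrpd.comparison F) ≫ IntGrpd.π₁map (IntGrpd.hKernelι F) =
      IntGrpd.π₁map (IntGrpd.kernelι F) := by
    rw [← IntGrpd.π₁map_comp, IntGrpd.comparison_comp_hKernelι]
  have hπ₀ : IntGrpd.π₀map (IntGrpd.comparison F) ≫ IntGrpd.π₀map (IntGrpd.hKernelι F) =
      IntGrpd.π₀map (IntGrpd.kernelι F) := by
    rw [← IntGrpd.π₀map_comp, IntGrpd.comparison_comp_hKernelι]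
  obtain ⟨δ, hδ⟩ : ∃ δ, δ ≫ IntGrpd.π₀map (IntGrpd.comparison F) = IntGrpd.snailD F :=
    ⟨IntGrpd.snailD F ≫ inv (IntGrpd.π₀map (IntGrpd.comparison F)), by
      rw [Category.assoc, IsIso.inv_hom_id, Category.comp_id]⟩
  refine ⟨IntGrpd.isIso_π₁map_comparison F, hJ, hπ₁, hπ₀, δ, hδ,
    IntGrpd.isExactAt_π₁map_kernelι F, ?_, ?_, IntGrpd.isExactAt_π₀map_kernelι hF hB⟩
  · refine IntGrpd.IsExactAt.of_comp_mono (IntGrpd.π₀map (IntGrpd.comparison F)) ?_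
    rw [hδ]
    exact IntGrpd.isExactAt_π₁map_snailD hK
  · refine IntGrpd.isExactAt_of_exists_lift ?_ fun {T} u hu => ?_
    · rw [← hπ₀, ← Category.assoc, hδ, IntGrpd.snailD, Category.assoc, IntGrpd.π₀π_map,
        ← Category.assoc, IntGrpd.snailΔ_map₀, zero_comp]
    · obtain ⟨S, p, b, hp, hb⟩ := IntGrpd.exists_snailD_lift hA u hu
      refine ⟨S, p, b, hp, ?_⟩
      rw [← cancel_mono (IntGrpd.π₀map (IntGrpd.comparison F)), Category.assoc, hδ, hb,
        Category.assoc]
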